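/- Let $M>0$, $K=lM+\Delta$ with $l\in\{1,2,\dots\}$ and $0\le\Delta<M$, let $m\in\{1,2,\dots\}$, $\bar X>0$ and $\lambda=m/\bar X$. Consider the storage process of the best-effort policy with buffer size $K$, $$B(i+1)=\min\big([B(i)-M]^++X(i),\,K\big),\qquad i\ge 0,\qquad [x]^+=\max(x,0),$$ where $X(0),X(1),\dots$ are i.i.d. Gamma distributed with pdf $f(x)=\frac{\lambda^m}{\Gamma(m)}x^{m-1}e^{-\lambda x}$, $x\ge 0$, and $B(0)$ is independent of $(X(i))_i$ with an arbitrary distribution on $[0,K]$. Then the process has a limiting distribution on $[0,K]$, i.e. a stationary probability distribution to which the law of $B(n)$ converges in total variation as $n\to\infty$, from every initial distribution. It consists of an atom of mass $\pi(K)$ at $K$ and a part with a pdf $g\ge 0$ on $(0,K)$. With $l'=l-1$ if $\Delta=0$ and $l'=l$ if $\Delta\ne 0$, the pdf is given in stripes by $$g(x)=g_n(x),\qquad [K-(n+1)M]^+\le x<K-nM,\qquad n=0,\dots,l',$$ $$g_n(x)=e^{-\lambda x}\sum_{r=0}^{m-1}\frac{\alpha_r}{r!}\Bigg[\sum_{q=0}^{n}\lambda^{(q+1)m-r}e^{-\lambda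 Mq}\frac{(qM+x-K)^{(q+1)m-r-1}}{((q+1)m-r-1)!}-\sum_{q=1}^{n}\lambda^{qm}e^{-\lambda Mq}\frac{(qM+x-K)^{qm-1}}{(qm-1)!}\Bigg],$$ and the probability of a full buffer is $$\pi(K)=e^{-\lambda K}\sum_{r=0}^{m-1}\frac{\alpha_r}{r!},$$ where $\alpha=(\alpha_0,\dots,\alpha_{m-1})^T\in\mathbb R^m$ is a solution of the linear system $(I+A)\alpha=(1,\dots,1)^T$ with the $m\times m$ matrix $A$ given, for $s,r=0,\dots,m-1$ and with $0^0=1$, by $$\begin{aligned}A_{sr}={}&\frac{1-K^s\lambda^s}{r!}\sum_{q=0}^{l}e^{-\lambda Mq}\sum_{t=qm}^{(q+1)m-r-1}\frac{(\lambda(qM-K))^t}{t!}+\frac{K^s\lambda^s}{r!}\sum_{q=0}^{l-1}e^{-\lambda M(q+1)}\sum_{t=qm}^{(q+1)m-r-1}\frac{(\lambda((q+1)M-K))^t}{t!}\\&+\frac{K^s\lambda^s}{r!}\sum_{t=0}^{s}\binom st K^{-t}\,t!\sum_{q=0}^{l-1}\lambda^{qm}e^{-\lambda M(q+1)}\Bigg[\frac{\lambda^{m-r}((q+1)M-K)^{(q+1)m-r+t}}{((q+1)m-r+t)!}-\frac{((q+1)M-K)^{qm+t}}{(qm+t)!}\Bigg].\end{aligned}$$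 Moreover, if $\sum_{k=0}^{m-1}\frac{(1-\lambda K)^k}{k!}\neq 0$ (which fails only if $m$ is even, and then for a single value of $\lambda K$), then $\alpha$ is the unique solution of this system. -/

import Mathlib

open MeasureTheory ProbabilityTheory Set Filter
open scoped Topology Nat Matrix

universe u

/-- One slot of the best-effort policy with buffer size `K` and desired transmit energy `M`:
stored energy `b` and harvested energy `x` give the next stored energy `min ([b - M]⁺ + x, K)`. -/
noncomputable def bestEffortStep (M K b x : ℝ) : ℝ :=
  min (max (b - M) 0 + x) K

/-- `B` is a best-effort storage process on the probability space `(Ω, P)`: it is driven by the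
i.i.d. energy harvesting process `X` with common law `μ`, and started from an arbitrary
`[0, K]`-valued random level `B 0` independent of `X`. -/
structure IsBestEffortStorage {Ω : Type u} [MeasurableSpace Ω] (P : Measure Ω)
    (M K : ℝ) (μ : Measure ℝ) (X B : ℕ → Ω → ℝ) : Prop where
  measurable_harvest : ∀ i, Measurable (X i)
  law_harvest : ∀ i, P.map (X i) = μ
  indep_harvest : iIndepFun X P
  measurable_init : Measurable (B 0)
  init_mem : ∀ᵐ ω ∂P, B 0 ω ∈ Icc 0 K
  indep_init : IndepFun (B 0) (fun ω i => X i ω) P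
  storage_eq : ∀ i ω, B (i + 1) ω = bestEffortStep M K (B i ω) (X i ω)

/-- `ν` is the limiting distribution of the best-effort storage process on the state space
`[0, K]`: it is a stationary probability distribution of the chain, and the law of `B n` converges
to `ν` in total variation whatever the initial distribution. -/
structure IsBestEffortLimit (M K : ℝ) (μ ν : Measure ℝ) : Prop where
  prob : IsProbabilityMeasure ν
  support : ∀ᵐ b ∂ν, b ∈ Icc 0 K
  stationary : (ν.prod μ).map (fun p : ℝ × ℝ => bestEffortStep M K p.1 p.2) = ν
  tendsto_totalVariation :
    ∀ (Ω : Type u) [MeasurableSpace Ω] (P : Measure Ω) [IsProbabilityMeasure P]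
      (X B : ℕ → Ω → ℝ), IsBestEffortStorage P M K μ X B →
      Tendsto (fun n => ⨆ S : {S : Set ℝ // MeasurableSet S},
        |(P.map (B n)).real S.1 - ν.real S.1|) atTop (𝓝 0)

/-- The function `g_n` giving the limiting pdf on the stripe `K - (n+1) M ≤ x < K - n M`. All
natural-number subtractions in the exponents are exact, since `r < m` and `q ≥ 1` in the second
sum over `q`. -/
noncomputable def stripePdf (m : ℕ) (M K lam : ℝ) (α : Fin m → ℝ) (n : ℕ) (x : ℝ) : ℝ :=
  Real.exp (-lam * x) * ∑ r : Fin m, α r / ((r : ℕ)! : ℝ) *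
    ((∑ q ∈ Finset.range (n + 1),
        lam ^ ((q + 1) * m - (r : ℕ)) * Real.exp (-lam * M * q) *
          (((q : ℝ) * M + x - K) ^ ((q + 1) * m - (r : ℕ) - 1)
            / (((q + 1) * m - (r : ℕ) - 1)! : ℝ)))
      - ∑ q ∈ Finset.Icc 1 n,
        lam ^ (q * m) * Real.exp (-lam * M * q) *
          (((q : ℝ) * M + x - K) ^ (q * m - 1) / ((q * m - 1)! : ℝ)))

/-- The matrix `A` of the linear system for the coefficients `α`. The index set
`Finset.Ico (q * m) ((q + 1) * m - r)` is `q m ≤ t ≤ (q + 1) m - r - 1`. -/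
noncomputable def coeffMatrix (m l : ℕ) (M K lam : ℝ) : Matrix (Fin m) (Fin m) ℝ :=
  fun s r =>
    (1 - K ^ (s : ℕ) * lam ^ (s : ℕ)) / ((r : ℕ)! : ℝ) *
      (∑ q ∈ Finset.range (l + 1), Real.exp (-lam * M * q) *
        ∑ t ∈ Finset.Ico (q * m) ((q + 1) * m - (r : ℕ)),
          (lam * ((q : ℝ) * M - K)) ^ t / (t ! : ℝ))
    + K ^ (s : ℕ) * (lam ^ (s : ℕ) / ((r : ℕ)! : ℝ)) *
      (∑ q ∈ Finset.range l, Real.exp (-lam * M * ((q : ℝ) + 1)) *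
        ∑ t ∈ Finset.Ico (q * m) ((q + 1) * m - (r : ℕ)),
          (lam * (((q : ℝ) + 1) * M - K)) ^ t / (t ! : ℝ))
    + K ^ (s : ℕ) * lam ^ (s : ℕ) / ((r : ℕ)! : ℝ) *
      ∑ t ∈ Finset.range ((s : ℕ) + 1),
        ((s : ℕ).choose t : ℝ) * (K ^ t)⁻¹ * (t ! : ℝ) *
          ∑ q ∈ Finset.range l, lam ^ (q * m) * Real.exp (-lam * M * ((q : ℝ) + 1)) *
            (lam ^ (m - (r : ℕ)) *
                (((q : ℝ) + 1) * M - K) ^ ((q + 1) * m - (r : ℕ) + t)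
                / (((q + 1) * m - (r : ℕ) + t)! : ℝ)
              - (((q : ℝ) + 1) * M - K) ^ (q * m + t) / ((q * m + t)! : ℝ))

/-! A harvest of at least `K` fills the buffer whatever its current level, and a Gamma harvest does
so with positive probability. So the chain regenerates at `K`: conditioning on the time since the
last such harvest gives a stationary law (`exists_stationary_bestEffort`), and the transition
operator shrinks oscillations by the factor `μ (Iio K) < 1`, which gives geometric convergence in
total variation (`bestEffort_contraction`).

For the density, continue the Erlang density at `x - [b - M]⁺` analytically: it is `exp (-λ x)`
times a polynomial in `x - K` with coefficients depending on `b`, and it is wrong only for `b > x +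
M`, where the true density is zero (`gammaPDFReal_sub_eq`). Integrating over a stationary law
expresses its pdf at `x` through `m` exponential moments `α` and a correction that sees only levels
above `x + M`. Given `α`, such an equation has at most one solution, found stripe by stripe from the
top (`eq_zero_of_eq_mul_integral_truncPow`). Truncated powers are closed under the convolution
involved, so the explicit `storagePdf` solves it for every coefficient vector
(`storagePdf_eq_topPdf_sub`), and the two pdfs agree when the coefficients are `α`.

For the linear system, let `T γ` be the total mass and `μ_s γ` the moments of the signed
distribution with coefficients `γ`. Direct integration gives `(A γ)_s = T γ - μ_s γ`
(`coeffMatrix_mulVec`). For the stationary law `T α = 1` and `μ_s α = α_s`, hence `(1 + A) α = 1`.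
If `(1 + A) γ = 0`, then `γ_s = μ_s γ - T γ`; balancing mass over one slot gives `T γ * ∑ (1 - λ K)
^ k / k! = 0`, so `T γ = 0` outside the exceptional case. The signed distribution is then invariant
with mass zero, strict contraction in L¹ makes it vanish, and `γ` vanishes with its moments. -/

/-! ### Stationary law by regeneration at a full buffer -/

theorem measurable_bestEffortStep (M K : ℝ) :
    Measurable (fun p : ℝ × ℝ => bestEffortStep M K p.1 p.2) := by
  unfold bestEffortStep; fun_prop

theorem bestEffortStep_eq_of_le {M K b x : ℝ} (hx : K ≤ x) : bestEffortStep M K b x = K := by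
  unfold bestEffortStep
  exact min_eq_right (by linarith [le_max_right (b - M) 0])

/-- The taboo measures whose sum is the stationary distribution: `n` slots after the last full
harvest. -/
noncomputable def tabooMeasure (M K : ℝ) (μ : Measure ℝ) : ℕ → Measure ℝ
  | 0 => μ (Ici K) • Measure.dirac K
  | n + 1 => ((tabooMeasure M K μ n).prod (μ.restrict (Iio K))).map
      (fun p : ℝ × ℝ => bestEffortStep M K p.1 p.2)

theorem tabooMeasure_univ (M K : ℝ) (μ : Measure ℝ) [IsProbabilityMeasure μ] (n : ℕ) :
    tabooMeasure M K μ n univ = μ (Ici K) * μ (Iio K) ^ n := by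
  induction n with
  | zero => simp [tabooMeasure]
  | succ n ih =>
    rw [tabooMeasure, Measure.map_apply (measurable_bestEffortStep M K) MeasurableSet.univ,
      preimage_univ, ← univ_prod_univ, Measure.prod_prod, ih, Measure.restrict_apply_univ]
    ring

/-- The masses of the taboo measures form a geometric series with sum 1. A slot with harvest below
`K` shifts the series by one term, and a filling harvest restores its first term. -/
theorem exists_stationary_bestEffort (M K : ℝ) (μ : Measure ℝ) [IsProbabilityMeasure μ]
    (h : μ (Ici K) ≠ 0) :
    ∃ ν : Measure ℝ, IsProbabilityMeasure ν ∧
      (ν.prod μ).map (fun p : ℝ × ℝ => bestEffortStep M K p.1 p.2) = ν := by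
  set ν := Measure.sum (tabooMeasure M K μ) with hν
  have hmass : ν univ = 1 := by
    rw [hν, Measure.sum_apply _ MeasurableSet.univ]
    simp_rw [tabooMeasure_univ]
    rw [ENNReal.tsum_mul_left, ENNReal.tsum_geometric]
    have : 1 - μ (Iio K) = μ (Ici K) := by
      rw [← compl_Iio, prob_compl_eq_one_sub measurableSet_Iio]
    rw [this]
    exact ENNReal.mul_inv_cancel h (measure_ne_top _ _)
  have hpr : IsProbabilityMeasure ν := ⟨hmass⟩
  refine ⟨ν, hpr, ?_⟩
  have hsplit : μ = μ.restrict (Iio K) + μ.restrict (Ici K) := by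
    rw [← compl_Iio]; exact (Measure.restrict_add_restrict_compl measurableSet_Iio).symm
  have hstep := measurable_bestEffortStep M K
  have h1 : (ν.prod (μ.restrict (Iio K))).map (fun p : ℝ × ℝ => bestEffortStep M K p.1 p.2)
      = Measure.sum (fun n => tabooMeasure M K μ (n + 1)) := by
    have : ∀ n, IsFiniteMeasure (tabooMeasure M K μ n) := fun n =>
      ⟨by rw [tabooMeasure_univ]; exact ENNReal.mul_lt_top (measure_lt_top _ _)
            (ENNReal.pow_lt_top (measure_lt_top _ _))⟩
    rw [hν, Measure.prod_sum_left, Measure.map_sum hstep.aemeasurable]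
    rfl
  have h2 : (ν.prod (μ.restrict (Ici K))).map (fun p : ℝ × ℝ => bestEffortStep M K p.1 p.2)
      = tabooMeasure M K μ 0 := by
    have hae : (fun p : ℝ × ℝ => bestEffortStep M K p.1 p.2)
        =ᵐ[ν.prod (μ.restrict (Ici K))] fun _ => K := by
      have : ∀ᵐ p ∂(ν.prod (μ.restrict (Ici K))), p.2 ∈ Ici K :=
        Measure.quasiMeasurePreserving_snd.ae (ae_restrict_mem measurableSet_Ici)
      filter_upwards [this] with p hp using bestEffortStep_eq_of_le hp
    rw [Measure.map_congr hae, Measure.map_const, ← univ_prod_univ, Measure.prod_prod, hmass,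
      one_mul, Measure.restrict_apply_univ]
    rfl
  conv_lhs => rw [hsplit, Measure.prod_add, Measure.map_add _ _ hstep, h1, h2]
  ext S hS
  rw [Measure.add_apply, hν, Measure.sum_apply _ hS, Measure.sum_apply _ hS,
    tsum_eq_zero_add' (f := fun i => tabooMeasure M K μ i S) ENNReal.summable, add_comm]

/-! ### Contraction of oscillations -/

section Contraction

variable {M K : ℝ} {μ : Measure ℝ} [IsProbabilityMeasure μ]

theorem abs_integral_sub_integral_le_of_osc {p q : Measure ℝ} [IsProbabilityMeasure p]
    [IsProbabilityMeasure q] {f : ℝ → ℝ} {c : ℝ} (hp : Integrable f p) (hq : Integrable f q)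
    (hosc : ∀ x y, |f x - f y| ≤ c) : |∫ x, f x ∂p - ∫ x, f x ∂q| ≤ c := by
  have key : ∀ {p q : Measure ℝ} [IsProbabilityMeasure p] [IsProbabilityMeasure q],
      Integrable f p → Integrable f q → ∫ x, f x ∂p - ∫ x, f x ∂q ≤ c := by
    intro p q _ _ hp hq
    have h1 : ∀ y, ∫ x, f x ∂p ≤ f y + c := by
      intro y
      calc ∫ x, f x ∂p ≤ ∫ _, (f y + c) ∂p :=
            integral_mono hp (integrable_const _) fun x => by
              have := (abs_le.1 (hosc x y)).2; simp only; linarith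
        _ = f y + c := by simp
    have h2 : ∫ x, f x ∂p - c ≤ ∫ y, f y ∂q := by
      calc ∫ x, f x ∂p - c = ∫ _, (∫ x, f x ∂p - c) ∂q := by simp
        _ ≤ ∫ y, f y ∂q := integral_mono (integrable_const _) hq fun y => by
              have := h1 y; simp only; linarith
    linarith
  exact abs_le.2 ⟨by linarith [key hq hp], key hp hq⟩

/-- Both starting levels receive the same harvest `z`. If `z ≥ K` they land together at `K`, so only
the event `z < K` contributes. -/
theorem bestEffort_osc_contraction {f : ℝ → ℝ} (hf : Measurable f) (hb : ∀ x, |f x| ≤ 1) {c : ℝ}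
    (hosc : ∀ x y, |f x - f y| ≤ c) (x y : ℝ) :
    |∫ z, f (bestEffortStep M K x z) ∂μ - ∫ z, f (bestEffortStep M K y z) ∂μ|
      ≤ c * μ.real (Iio K) := by
  have hm : ∀ x, Measurable fun z => f (bestEffortStep M K x z) := fun x =>
    hf.comp ((measurable_bestEffortStep M K).comp (measurable_const.prodMk measurable_id))
  have hi : ∀ x, Integrable (fun z => f (bestEffortStep M K x z)) μ := fun x =>
    Integrable.of_bound (hm x).aestronglyMeasurable 1 (ae_of_all _ fun z => hb _)
  rw [← integral_sub (hi x) (hi y)]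
  have hc : ∫ z, (Iio K).indicator (fun _ => c) z ∂μ = c * μ.real (Iio K) := by
    rw [integral_indicator measurableSet_Iio]; simp [mul_comm]
  rw [← hc]
  refine (abs_integral_le_integral_abs).trans (integral_mono ((hi x).sub (hi y)).abs
    ((integrable_const c).indicator measurableSet_Iio) fun z => ?_)
  by_cases hz : z < K
  · simpa [indicator, hz] using hosc _ _
  · have hz' := not_lt.1 hz
    simp [indicator, hz, bestEffortStep_eq_of_le hz']

theorem integral_map_bestEffortStep (p : Measure ℝ) [IsProbabilityMeasure p] {f : ℝ → ℝ}
    (hf : Measurable f) (hb : ∀ x, |f x| ≤ 1) :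
    ∫ x, f x ∂((p.prod μ).map (fun q : ℝ × ℝ => bestEffortStep M K q.1 q.2))
      = ∫ b, ∫ z, f (bestEffortStep M K b z) ∂μ ∂p := by
  have hstep := measurable_bestEffortStep M K
  rw [integral_map hstep.aemeasurable hf.aestronglyMeasurable, integral_prod]
  exact Integrable.of_bound (hf.comp hstep).aestronglyMeasurable 1 (ae_of_all _ fun z => hb _)

/-- Duality: one slot is moved from the measures to the test function, whose oscillation shrinks by
`μ.real (Iio K)`. The bound by 1 on `f` provides integrability, while `c` tracks the oscillation. -/
theorem bestEffort_contraction (p q : ℕ → Measure ℝ) [∀ n, IsProbabilityMeasure (p n)]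
    [∀ n, IsProbabilityMeasure (q n)]
    (hp : ∀ n, p (n + 1) = ((p n).prod μ).map (fun a : ℝ × ℝ => bestEffortStep M K a.1 a.2))
    (hq : ∀ n, q (n + 1) = ((q n).prod μ).map (fun a : ℝ × ℝ => bestEffortStep M K a.1 a.2))
    (n : ℕ) {f : ℝ → ℝ} (hf : Measurable f) (hb : ∀ x, |f x| ≤ 1) {c : ℝ}
    (hosc : ∀ x y, |f x - f y| ≤ c) :
    |∫ x, f x ∂(p n) - ∫ x, f x ∂(q n)| ≤ c * μ.real (Iio K) ^ n := by
  induction n generalizing f c with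
  | zero =>
    rw [pow_zero, mul_one]
    exact abs_integral_sub_integral_le_of_osc
      (Integrable.of_bound hf.aestronglyMeasurable 1 (ae_of_all _ fun z => hb _))
      (Integrable.of_bound hf.aestronglyMeasurable 1 (ae_of_all _ fun z => hb _)) hosc
  | succ n ih =>
    rw [hp, hq, integral_map_bestEffortStep _ hf hb, integral_map_bestEffortStep _ hf hb,
      pow_succ', ← mul_assoc]
    have hm : Measurable fun a : ℝ × ℝ => f (bestEffortStep M K a.1 a.2) :=
      hf.comp (measurable_bestEffortStep M K)
    refine ih (f := fun b => ∫ z, f (bestEffortStep M K b z) ∂μ)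
      (hm.stronglyMeasurable.integral_prod_right' (ν := μ)).measurable (fun b => ?_)
      (bestEffort_osc_contraction hf hb hosc)
    have := norm_integral_le_of_norm_le_const (μ := μ) (C := 1)
      (f := fun z => f (bestEffortStep M K b z)) (ae_of_all _ fun z => hb _)
    simpa using this

end Contraction

/-! ### Laws of the storage process and their convergence -/

namespace IsBestEffortStorage

variable {Ω : Type u} [MeasurableSpace Ω] {P : Measure Ω} {M K : ℝ}
  {μ : Measure ℝ} {X B : ℕ → Ω → ℝ}

theorem exists_eq_init_harvest (h : IsBestEffortStorage P M K μ X B) (n : ℕ) :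
    ∃ F : ℝ × (Finset.range n → ℝ) → ℝ, Measurable F ∧
      ∀ ω, B n ω = F (B 0 ω, fun i => X i ω) := by
  induction n with
  | zero => exact ⟨Prod.fst, measurable_fst, fun ω => rfl⟩
  | succ n ih =>
    obtain ⟨F, hF, hB⟩ := ih
    refine ⟨fun a => bestEffortStep M K (F (a.1, fun i => a.2 ⟨i, Finset.mem_range.2
      ((Finset.mem_range.1 i.2).trans n.lt_succ_self)⟩)) (a.2 ⟨n, Finset.self_mem_range_succ n⟩),
      ?_, fun ω => ?_⟩
    · refine (measurable_bestEffortStep M K).comp (Measurable.prodMk (hF.comp ?_) ?_)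
      · fun_prop
      · fun_prop
    · rw [h.storage_eq, hB]

theorem indepFun_harvest [IsProbabilityMeasure P] (h : IsBestEffortStorage P M K μ X B) (n : ℕ) :
    IndepFun (B n) (X n) P := by
  obtain ⟨F, hF, hB⟩ := h.exists_eq_init_harvest n
  set Z : Ω → (Finset.range n → ℝ) := fun ω i => X i ω with hZdef
  have hZ : Measurable Z := measurable_pi_lambda _ fun i => h.measurable_harvest i
  have hX := h.measurable_harvest n
  have h0 := h.measurable_init
  have hZX : IndepFun Z (X n) P := by
    have := h.indep_harvest.indepFun_finset (Finset.range n) {n} (by simp) h.measurable_harvest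
    have hz : Measurable fun z : (({n} : Finset ℕ) → ℝ) => z ⟨n, by simp⟩ := by fun_prop
    exact this.comp measurable_id hz
  have h0ZX : IndepFun (B 0) (fun ω => (Z ω, X n ω)) P := by
    have hz : Measurable fun x : ℕ → ℝ => ((fun i : Finset.range n => x i), x n) := by fun_prop
    exact h.indep_init.comp measurable_id hz
  have h0Z : IndepFun (B 0) Z P := h0ZX.comp measurable_id measurable_fst
  have hpair : IndepFun (fun ω => (B 0 ω, Z ω)) (X n) P := by
    rw [indepFun_iff_map_prod_eq_prod_map_map (h0.prodMk hZ).aemeasurable hX.aemeasurable]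
    rw [indepFun_iff_map_prod_eq_prod_map_map h0.aemeasurable (hZ.prodMk hX).aemeasurable] at h0ZX
    rw [indepFun_iff_map_prod_eq_prod_map_map hZ.aemeasurable hX.aemeasurable] at hZX
    rw [indepFun_iff_map_prod_eq_prod_map_map h0.aemeasurable hZ.aemeasurable] at h0Z
    have := Measure.isProbabilityMeasure_map (μ := P) h0.aemeasurable
    have := Measure.isProbabilityMeasure_map (μ := P) hZ.aemeasurable
    have := Measure.isProbabilityMeasure_map (μ := P) hX.aemeasurable
    -- The joint law of `B 0`, `Z`, `X n` is a triple product; reassociating it separates `(B 0, Z)`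
    -- from `X n`.
    rw [h0Z, ← (measurePreserving_prodAssoc _ _ _).symm.map_eq, ← hZX, ← h0ZX,
      Measure.map_map MeasurableEquiv.prodAssoc.symm.measurable (h0.prodMk (hZ.prodMk hX))]
    rfl
  have := hpair.comp hF measurable_id
  have hBn : B n = F ∘ fun ω => (B 0 ω, Z ω) := funext hB
  rw [hBn]; exact this

theorem measurable_storage (h : IsBestEffortStorage P M K μ X B) (n : ℕ) : Measurable (B n) := by
  obtain ⟨F, hF, hB⟩ := h.exists_eq_init_harvest n
  rw [show B n = fun ω => F (B 0 ω, fun i : Finset.range n => X i ω) from funext hB]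
  exact hF.comp (h.measurable_init.prodMk (measurable_pi_lambda _ fun i => h.measurable_harvest i))

theorem map_succ [IsProbabilityMeasure P] (h : IsBestEffortStorage P M K μ X B) (n : ℕ) :
    P.map (B (n + 1)) =
      ((P.map (B n)).prod μ).map (fun a : ℝ × ℝ => bestEffortStep M K a.1 a.2) := by
  have hB := h.measurable_storage n
  have hX := h.measurable_harvest n
  rw [← h.law_harvest n, ← (indepFun_iff_map_prod_eq_prod_map_map hB.aemeasurable
    hX.aemeasurable).1 (h.indepFun_harvest n),
    Measure.map_map (measurable_bestEffortStep M K) (hB.prodMk hX)]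
  congr 1
  exact funext (h.storage_eq n)

theorem tendsto_totalVariation [IsProbabilityMeasure P] [IsProbabilityMeasure μ] (h : IsBestEffortStorage P M K μ X B)
    {ν : Measure ℝ} [IsProbabilityMeasure ν]
    (hν : (ν.prod μ).map (fun a : ℝ × ℝ => bestEffortStep M K a.1 a.2) = ν)
    (hK : μ (Ici K) ≠ 0) :
    Tendsto (fun n => ⨆ S : {S : Set ℝ // MeasurableSet S},
        |(P.map (B n)).real S.1 - ν.real S.1|) atTop (𝓝 0) := by
  have : ∀ n, IsProbabilityMeasure (P.map (B n)) := fun n =>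
    Measure.isProbabilityMeasure_map (h.measurable_storage n).aemeasurable
  have hlt : μ.real (Iio K) < 1 := by
    have h1 : μ.real (Iio K) = 1 - μ.real (Ici K) := by
      rw [← compl_Ici, probReal_compl_eq_one_sub measurableSet_Ici]
    have h2 : 0 < μ.real (Ici K) := ENNReal.toReal_pos hK (measure_ne_top _ _)
    linarith
  refine squeeze_zero (fun n => Real.iSup_nonneg fun S => abs_nonneg _) (fun n => ?_)
    (tendsto_pow_atTop_nhds_zero_of_lt_one measureReal_nonneg hlt)
  have : Nonempty {S : Set ℝ // MeasurableSet S} := ⟨⟨univ, MeasurableSet.univ⟩⟩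
  refine ciSup_le fun S => ?_
  -- Indicators have oscillation at most 1, so the bound is uniform over measurable sets.
  have := bestEffort_contraction (M := M) (K := K) (μ := μ) (fun n => P.map (B n)) (fun _ => ν)
    h.map_succ (fun _ => hν.symm) n (f := S.1.indicator 1) (measurable_one.indicator S.2)
    (fun x => by by_cases hx : x ∈ S.1 <;> simp [hx]) (c := 1)
    (fun x y => by by_cases hx : x ∈ S.1 <;> by_cases hy : y ∈ S.1 <;> simp [hx, hy])
  rwa [integral_indicator_one S.2, integral_indicator_one S.2, one_mul] at this

end IsBestEffortStorage

theorem IsBestEffortLimit.of_stationary {M K : ℝ} (hK : 0 ≤ K) {μ ν : Measure ℝ}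
    [IsProbabilityMeasure μ] [IsProbabilityMeasure ν]
    (hν : (ν.prod μ).map (fun a : ℝ × ℝ => bestEffortStep M K a.1 a.2) = ν)
    (hμ : ∀ᵐ x ∂μ, 0 ≤ x) (hμK : μ (Ici K) ≠ 0) : IsBestEffortLimit.{u} M K μ ν where
  prob := inferInstance
  support := by
    rw [← hν]
    refine (ae_map_iff (measurable_bestEffortStep M K).aemeasurable measurableSet_Icc).2 ?_
    filter_upwards [Measure.quasiMeasurePreserving_snd.ae hμ] with p hp
    exact ⟨le_min (add_nonneg (le_max_right _ _) hp) hK, min_le_right _ _⟩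
  stationary := hν
  tendsto_totalVariation _ _ _ _ _ _ h := h.tendsto_totalVariation hν hμK

/-! ### Truncated powers and their integrals -/

/-- The divided power `u ^ n / n!`, truncated to negative arguments. -/
noncomputable def truncPow (n : ℕ) (u : ℝ) : ℝ := if u < 0 then u ^ n / (n ! : ℝ) else 0

theorem truncPow_of_neg {u : ℝ} (n : ℕ) (hu : u < 0) : truncPow n u = u ^ n / (n ! : ℝ) :=
  if_pos hu

theorem truncPow_of_nonneg {u : ℝ} (n : ℕ) (hu : 0 ≤ u) : truncPow n u = 0 :=
  if_neg (not_lt.2 hu)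

/-- The strict inequality in `truncPow` makes even the zeroth power vanish at 0, hence `n ≠ 0`. This
convention fits stripes that are closed on the left. -/
theorem truncPow_of_nonpos {u : ℝ} {n : ℕ} (hn : n ≠ 0) (hu : u ≤ 0) :
    truncPow n u = u ^ n / (n ! : ℝ) := by
  rcases hu.lt_or_eq with h | h
  · exact truncPow_of_neg n h
  · rw [truncPow_of_nonneg n h.ge, h, zero_pow hn, zero_div]

@[fun_prop]
theorem measurable_truncPow (n : ℕ) : Measurable (truncPow n) :=
  Measurable.ite measurableSet_Iio (by fun_prop) measurable_const

theorem abs_truncPow_le (n : ℕ) (u : ℝ) : |truncPow n u| ≤ |u| ^ n := by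
  unfold truncPow
  split_ifs
  · rw [abs_div, abs_pow, Nat.abs_cast]
    exact div_le_self (by positivity) (by exact_mod_cast n.factorial_pos)
  · simp

theorem hasDerivAt_pow_div_factorial (n : ℕ) (x : ℝ) :
    HasDerivAt (fun u : ℝ => u ^ (n + 1) / ((n + 1)! : ℝ)) (x ^ n / (n ! : ℝ)) x := by
  have h := (hasDerivAt_pow (n + 1) x).div_const ((n + 1)! : ℝ)
  refine h.congr_deriv ?_
  have h1 : (n ! : ℝ) ≠ 0 := by positivity
  rw [Nat.factorial_succ]
  push_cast
  have h2 : (n : ℝ) + 1 ≠ 0 := by positivity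
  field_simp

/-- A Beta integral by parts: each step moves one power from `c - b` to `b - d`, and the boundary
terms vanish because one factor is zero at each end. -/
theorem integral_pow_mul_pow_div_factorial (t N : ℕ) (c d : ℝ) :
    ∫ b in c..d, (c - b) ^ t / (t ! : ℝ) * ((b - d) ^ N / (N ! : ℝ))
      = -((c - d) ^ (t + N + 1) / ((t + N + 1)! : ℝ)) := by
  induction t generalizing N with
  | zero =>
    have hd : ∀ b ∈ uIcc c d, HasDerivAt (fun b => (b - d) ^ (N + 1) / ((N + 1)! : ℝ))
        ((b - d) ^ N / (N ! : ℝ)) b := fun b _ => by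
      have h := (hasDerivAt_pow_div_factorial N (b - d)).comp b ((hasDerivAt_id b).sub_const d)
      rw [mul_one] at h
      exact h
    simp only [pow_zero, Nat.factorial_zero, Nat.cast_one, div_one, one_mul]
    rw [intervalIntegral.integral_eq_sub_of_hasDerivAt hd
      (Continuous.intervalIntegrable (by fun_prop) _ _)]
    simp
  | succ t ih =>
    have hd : ∀ b ∈ uIcc c d, HasDerivAt
        (fun b => (c - b) ^ (t + 1) / ((t + 1)! : ℝ) * ((b - d) ^ (N + 1) / ((N + 1)! : ℝ)))
        ((c - b) ^ (t + 1) / ((t + 1)! : ℝ) * ((b - d) ^ N / (N ! : ℝ))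
          - (c - b) ^ t / (t ! : ℝ) * ((b - d) ^ (N + 1) / ((N + 1)! : ℝ))) b := fun b _ => by
      have h1 := (hasDerivAt_pow_div_factorial N (b - d)).comp b
        ((hasDerivAt_id b).sub_const d)
      have h2 := (hasDerivAt_pow_div_factorial t (c - b)).comp b
        ((hasDerivAt_id b).const_sub c)
      refine (h2.mul h1).congr_deriv ?_
      simp only [Function.comp, id]
      ring
    have h := intervalIntegral.integral_eq_sub_of_hasDerivAt hd
      (Continuous.intervalIntegrable (by fun_prop) _ _)
    rw [intervalIntegral.integral_sub (Continuous.intervalIntegrable (by fun_prop) _ _)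
      (Continuous.intervalIntegrable (by fun_prop) _ _), ih (N + 1)] at h
    simp only [sub_self, ne_eq, Nat.add_eq_zero_iff, one_ne_zero, and_false, not_false_eq_true,
      zero_pow, zero_div, zero_mul, mul_zero, sub_neg_eq_add] at h
    rw [show t + 1 + N + 1 = t + (N + 1) + 1 by ring]
    linarith

/-- The product is supported on `c < b < d`, an interval that `hc` and `hd` place inside `(0, K)`.
This closure under convolution is what keeps all the pdfs explicit. -/
theorem integral_truncPow_mul_truncPow (t N : ℕ) {c d K : ℝ} (hc : 0 ≤ c) (hd : d ≤ K) :
    ∫ b in Ioo 0 K, truncPow t (c - b) * truncPow N (b - d) = -truncPow (t + N + 1) (c - d) := by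
  have h : ∀ b, truncPow t (c - b) * truncPow N (b - d)
      = (Ioo c d).indicator
        (fun b => (c - b) ^ t / (t ! : ℝ) * ((b - d) ^ N / (N ! : ℝ))) b := by
    intro b
    by_cases h1 : c < b <;> by_cases h2 : b < d <;> simp [truncPow, indicator, h1, h2]
  simp_rw [h]
  rw [setIntegral_indicator measurableSet_Ioo, inter_eq_right.2 (Ioo_subset_Ioo hc hd)]
  rcases lt_or_ge c d with hcd | hcd
  · rw [← integral_Ioc_eq_integral_Ioo, ← intervalIntegral.integral_of_le hcd.le,
      integral_pow_mul_pow_div_factorial, truncPow_of_neg _ (sub_neg.2 hcd)]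
  · rw [Ioo_eq_empty (not_lt.2 hcd), truncPow_of_nonneg _ (sub_nonneg.2 hcd)]
    simp

/-- The derivative telescopes: differentiating the exponential cancels the differentiated partial
sum except for its top term. -/
theorem hasDerivAt_exp_mul_sum (lam d : ℝ) (N : ℕ) (b : ℝ) :
    HasDerivAt (fun b => -(Real.exp (-lam * b) *
        ∑ t ∈ Finset.range (N + 1), (lam * (b - d)) ^ t / (t ! : ℝ)))
      (lam ^ (N + 1) * (Real.exp (-lam * b) * ((b - d) ^ N / (N ! : ℝ)))) b := by
  have he : HasDerivAt (fun b => Real.exp (-lam * b)) (Real.exp (-lam * b) * (-lam)) b := by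
    simpa using ((hasDerivAt_id b).const_mul (-lam)).exp
  have hu : HasDerivAt (fun b => lam * (b - d)) lam b := by
    simpa using ((hasDerivAt_id b).sub_const d).const_mul lam
  induction N with
  | zero =>
    refine he.neg.congr_of_eventuallyEq (Eventually.of_forall fun b => ?_) |>.congr_deriv ?_
    · simp
    · simp; ring
  | succ N ih =>
    have h := ih.sub (he.mul ((hasDerivAt_pow_div_factorial N _).comp b hu))
    refine (h.congr_of_eventuallyEq (Eventually.of_forall fun b => ?_)).congr_deriv ?_
    · simp only [Pi.sub_apply, Pi.mul_apply, Function.comp]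
      rw [Finset.sum_range_succ _ (N + 1)]
      ring
    · simp only [Function.comp, mul_pow]
      ring

theorem integral_exp_mul_pow (lam c d : ℝ) (N : ℕ) :
    ∫ b in c..d, lam ^ (N + 1) * (Real.exp (-lam * b) * ((b - d) ^ N / (N ! : ℝ)))
      = Real.exp (-lam * c) * (∑ t ∈ Finset.range (N + 1), (lam * (c - d)) ^ t / (t ! : ℝ))
        - Real.exp (-lam * d) := by
  rw [intervalIntegral.integral_eq_sub_of_hasDerivAt
    (fun b _ => hasDerivAt_exp_mul_sum lam d N b) (Continuous.intervalIntegrable (by fun_prop) _ _)]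
  rw [Finset.sum_eq_single 0]
  · simp
    ring
  · intro t _ ht
    simp [ht]
  · simp

theorem integral_exp_mul_truncPow (lam : ℝ) (N : ℕ) {c d K : ℝ} (hc : 0 ≤ c) (hcd : c ≤ d)
    (hd : d ≤ K) :
    lam ^ (N + 1) * ∫ b in Ioo 0 K,
        (Ici c).indicator 1 b * (Real.exp (-lam * b) * truncPow N (b - d))
      = Real.exp (-lam * c) * (∑ t ∈ Finset.range (N + 1), (lam * (c - d)) ^ t / (t ! : ℝ))
        - Real.exp (-lam * d) := by
  rw [← integral_exp_mul_pow, intervalIntegral.integral_const_mul]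
  congr 1
  have h : ∀ b, (Ici c).indicator 1 b * (Real.exp (-lam * b) * truncPow N (b - d))
      = (Ico c d).indicator
        (fun b => Real.exp (-lam * b) * ((b - d) ^ N / (N ! : ℝ))) b := by
    intro b
    by_cases h1 : c ≤ b <;> by_cases h2 : b < d <;> simp [truncPow, indicator, h1, h2]
  simp_rw [h]
  rw [← setIntegral_congr_set (Ioo_ae_eq_Ico.symm : Ico (0 : ℝ) K =ᵐ[volume] Ioo 0 K),
    setIntegral_indicator measurableSet_Ico, inter_eq_right.2 (Ico_subset_Ico hc hd),
    intervalIntegral.integral_of_le hcd, integral_Ico_eq_integral_Ioo,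
    integral_Ioc_eq_integral_Ioo]

theorem integral_exp_mul_truncPow_of_lt (lam : ℝ) (N : ℕ) {c d K : ℝ} (hcd : d ≤ c) :
    ∫ b in Ioo 0 K, (Ici c).indicator 1 b * (Real.exp (-lam * b) * truncPow N (b - d)) = 0 := by
  have h : ∀ b, (Ici c).indicator 1 b * (Real.exp (-lam * b) * truncPow N (b - d)) = 0 := by
    intro b
    by_cases h1 : c ≤ b
    · rw [truncPow_of_nonneg _ (by linarith)]; simp
    · simp [indicator, h1]
  simp_rw [h]
  simp

/-! ### Erlang density and survival function -/

theorem gammaPDFReal_nat {m : ℕ} (hm : 1 ≤ m) (lam u : ℝ) :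
    gammaPDFReal m lam u =
      if 0 ≤ u then lam ^ m * Real.exp (-lam * u) * (u ^ (m - 1) / ((m - 1)! : ℝ)) else 0 := by
  unfold gammaPDFReal
  have h1 : ((m : ℝ) - 1) = ((m - 1 : ℕ) : ℝ) := by push_cast [hm]; ring
  have h2 : Real.Gamma m = ((m - 1)! : ℝ) := by
    have := Real.Gamma_nat_eq_factorial (m - 1)
    rwa [← h1, sub_add_cancel] at this
  rw [h1, h2, Real.rpow_natCast, Real.rpow_natCast]
  split_ifs
  · rw [neg_mul]; ring
  · rfl

/-- The survival function of the Gamma (Erlang) distribution of shape `m` and rate `lam`. -/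
noncomputable def erlangTail (m : ℕ) (lam c : ℝ) : ℝ :=
  Real.exp (-lam * c) * ∑ t ∈ Finset.range m, (lam * c) ^ t / (t ! : ℝ)

theorem erlangTail_zero {m : ℕ} (hm : 1 ≤ m) (lam : ℝ) : erlangTail m lam 0 = 1 := by
  unfold erlangTail
  rw [Finset.sum_eq_single_of_mem 0 (Finset.mem_range.2 hm) fun t _ ht => by simp [ht]]
  simp

theorem erlangTail_antitone {m : ℕ} (hm : 1 ≤ m) {lam : ℝ} (hlam : 0 < lam) {c d : ℝ}
    (hc : 0 ≤ c) (hcd : c ≤ d) : erlangTail m lam d ≤ erlangTail m lam c := by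
  obtain ⟨n, rfl⟩ : ∃ n, m = n + 1 := ⟨m - 1, by omega⟩
  have h : ∫ b in c..d, lam ^ (n + 1) * (Real.exp (-lam * b) * ((b - 0) ^ n / (n ! : ℝ)))
      = erlangTail (n + 1) lam c - erlangTail (n + 1) lam d := by
    rw [intervalIntegral.integral_eq_sub_of_hasDerivAt
      (fun b _ => hasDerivAt_exp_mul_sum lam 0 n b)
      (Continuous.intervalIntegrable (by fun_prop) _ _)]
    simp only [erlangTail, sub_zero]
    ring
  have h0 : 0 ≤ ∫ b in c..d, lam ^ (n + 1) * (Real.exp (-lam * b) * ((b - 0) ^ n / (n ! : ℝ))) :=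
    intervalIntegral.integral_nonneg hcd fun b hb => by
      have := hc.trans hb.1
      rw [sub_zero]
      positivity
  linarith

theorem integral_gammaPDFReal {m : ℕ} (hm : 1 ≤ m) (lam : ℝ) {y K : ℝ} (hy : 0 ≤ y)
    (hyK : y ≤ K) :
    ∫ x in Ioo 0 K, gammaPDFReal m lam (x - y) = 1 - erlangTail m lam (K - y) := by
  obtain ⟨n, rfl⟩ : ∃ n, m = n + 1 := ⟨m - 1, by omega⟩
  have h : ∀ x, gammaPDFReal (n + 1 : ℕ) lam (x - y) = (Ici y).indicator (fun x =>
      lam ^ (n + 1) * Real.exp (-lam * (x - y)) * ((x - y) ^ n / (n ! : ℝ))) x := by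
    intro x
    rw [gammaPDFReal_nat hm]
    by_cases hx : y ≤ x <;> simp [indicator, hx]
  simp_rw [h]
  rw [← setIntegral_congr_set (Ioo_ae_eq_Ico.symm : Ico (0 : ℝ) K =ᵐ[volume] Ioo 0 K),
    setIntegral_indicator measurableSet_Ici]
  have hs : Ico 0 K ∩ Ici y = Ico y K := by
    ext x; simp only [mem_inter_iff, mem_Ico, mem_Ici]; constructor
    · rintro ⟨⟨_, h2⟩, h3⟩; exact ⟨h3, h2⟩
    · rintro ⟨h1, h2⟩; exact ⟨⟨hy.trans h1, h2⟩, h1⟩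
  rw [hs, integral_Ico_eq_integral_Ioo, ← integral_Ioc_eq_integral_Ioo,
    ← intervalIntegral.integral_of_le hyK,
    intervalIntegral.integral_comp_sub_right
      (fun u => lam ^ (n + 1) * Real.exp (-lam * u) * (u ^ n / (n ! : ℝ))) y, sub_self]
  have hd := intervalIntegral.integral_eq_sub_of_hasDerivAt (a := 0) (b := K - y)
      (fun b _ => hasDerivAt_exp_mul_sum lam 0 n b)
      (Continuous.intervalIntegrable (by fun_prop) _ _)
  simp only [sub_zero] at hd
  have h0 := erlangTail_zero hm lam
  unfold erlangTail at h0 ⊢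
  rw [h0] at hd
  simp_rw [mul_assoc, hd]
  ring

/-! ### Moment expansion of the transition density -/

/-- The pdf on the top stripe, continued analytically. -/
noncomputable def topPdf (m : ℕ) (K lam : ℝ) (γ : Fin m → ℝ) (x : ℝ) : ℝ :=
  Real.exp (-lam * x) * ∑ r : Fin m, γ r / ((r : ℕ)! : ℝ) *
    (lam ^ (m - (r : ℕ)) * ((x - K) ^ (m - (r : ℕ) - 1) / ((m - (r : ℕ) - 1)! : ℝ)))

/-- The mass at a full buffer with coefficients `γ`. -/
noncomputable def fullMass (m : ℕ) (K lam : ℝ) (γ : Fin m → ℝ) : ℝ :=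
  Real.exp (-lam * K) * ∑ r : Fin m, γ r / ((r : ℕ)! : ℝ)

/-- The exponential moments of the (signed) distribution of the stored energy with density `w`
with respect to `ρ`, which determine the pdf on the top stripe. -/
noncomputable def storageMoment (m : ℕ) (M K lam : ℝ) (ρ : Measure ℝ) (w : ℝ → ℝ) (r : Fin m) : ℝ :=
  ∫ b, lam ^ (r : ℕ) * (K - max (b - M) 0) ^ (r : ℕ) * Real.exp (lam * max (b - M) 0) * w b ∂ρ

theorem exists_bound_Icc {f : ℝ → ℝ} (hf : Continuous f) (K : ℝ) :
    ∃ C, ∀ b ∈ Icc 0 K, |f b| ≤ C :=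
  isCompact_Icc.exists_bound_of_continuousOn hf.continuousOn

theorem integrable_mul_of_bound_Icc {K : ℝ} {ρ : Measure ℝ} {w f : ℝ → ℝ}
    (hρ : ∀ᵐ b ∂ρ, b ∈ Icc 0 K) (hw : Integrable w ρ) (hf : Measurable f)
    (hb : ∃ C, ∀ b ∈ Icc 0 K, |f b| ≤ C) : Integrable (fun b => f b * w b) ρ := by
  obtain ⟨C, hC⟩ := hb
  exact hw.bdd_mul hf.aestronglyMeasurable (hρ.mono fun b h => hC b h)

theorem integrable_continuous_mul {K : ℝ} {ρ : Measure ℝ} {w f : ℝ → ℝ}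
    (hρ : ∀ᵐ b ∂ρ, b ∈ Icc 0 K) (hw : Integrable w ρ) (hf : Continuous f) :
    Integrable (fun b => f b * w b) ρ :=
  integrable_mul_of_bound_Icc hρ hw hf.measurable (exists_bound_Icc hf K)

theorem exists_bound_truncPow_mul_exp (n : ℕ) (c lam K : ℝ) :
    ∃ C, ∀ b ∈ Icc 0 K, |truncPow n (c - b) * Real.exp (lam * b)| ≤ C := by
  obtain ⟨C, hC⟩ := exists_bound_Icc
    (f := fun b => |c - b| ^ n * Real.exp (lam * b)) (by fun_prop) K
  refine ⟨C, fun b hb => le_trans ?_ (hC b hb)⟩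
  rw [abs_mul, abs_mul, abs_pow, abs_abs]
  gcongr
  exact abs_truncPow_le _ _

/-- Write `Y = max (b - M) 0`. Expanding `x - Y = (K - Y) + (x - K)` binomially separates `b` from
`x` in the continued density. As `x ≥ 0`, the true density is cut off (`x < Y`) exactly when `x + M
< b`; there `Y = b - M`, so the excess is a truncated power of `x + M - b`. -/
theorem gammaPDFReal_sub_eq {m : ℕ} (hm : 1 ≤ m) {M K lam x : ℝ} (hx : 0 ≤ x)
    (b : ℝ) :
    gammaPDFReal m lam (x - max (b - M) 0)
      = topPdf m K lam (fun r => lam ^ (r : ℕ) * (K - max (b - M) 0) ^ (r : ℕ)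
          * Real.exp (lam * max (b - M) 0)) x
        - lam ^ m * Real.exp (-lam * (x + M)) *
          (truncPow (m - 1) (x + M - b) * Real.exp (lam * b)) := by
  obtain ⟨n, rfl⟩ : ∃ n, m = n + 1 := ⟨m - 1, by omega⟩
  set Y := max (b - M) 0 with hY
  have htop : topPdf (n + 1) K lam (fun r => lam ^ (r : ℕ) * (K - Y) ^ (r : ℕ)
          * Real.exp (lam * Y)) x
        = lam ^ (n + 1) * Real.exp (-lam * (x - Y)) * ((x - Y) ^ n / (n ! : ℝ)) := by
    unfold topPdf
    rw [Fin.sum_univ_eq_sum_range (fun r => lam ^ r * (K - Y) ^ r * Real.exp (lam * Y) / (r ! : ℝ) *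
      (lam ^ (n + 1 - r) * ((x - K) ^ (n + 1 - r - 1) / ((n + 1 - r - 1)! : ℝ))))]
    rw [show x - Y = (K - Y) + (x - K) by ring, add_pow, Finset.sum_div, Finset.mul_sum,
      Finset.mul_sum]
    refine Finset.sum_congr rfl fun r hr => ?_
    have hrn : r ≤ n := Nat.lt_succ_iff.1 (Finset.mem_range.1 hr)
    have hE : Real.exp (-lam * (K - Y + (x - K)))
        = Real.exp (-lam * x) * Real.exp (lam * Y) := by
      rw [← Real.exp_add]; congr 1; ring
    have hch : ((n.choose r : ℕ) : ℝ) * (r ! : ℝ) * ((n - r)! : ℝ) = (n ! : ℝ) := by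
      exact_mod_cast Nat.choose_mul_factorial_mul_factorial hrn
    rw [hE, show n + 1 - r - 1 = n - r by omega, ← pow_sub_mul_pow lam (show r ≤ n + 1 by omega),
      ← hch]
    have h1 : (r ! : ℝ) ≠ 0 := by positivity
    have h2 : ((n - r)! : ℝ) ≠ 0 := by positivity
    have h3 : ((n.choose r : ℕ) : ℝ) ≠ 0 := by exact_mod_cast (Nat.choose_pos hrn).ne'
    field_simp
  rw [htop, gammaPDFReal_nat hm, Nat.add_sub_cancel]
  by_cases h : Y ≤ x
  · have hb : 0 ≤ x + M - b := by linarith [le_max_left (b - M) 0]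
    rw [if_pos (sub_nonneg.2 h), truncPow_of_nonneg _ hb]
    ring
  · rw [not_le] at h
    have hYb : Y = b - M := max_eq_left (by
      rcases max_choice (b - M) 0 with h' | h' <;> linarith [h', le_max_left (b - M) 0])
    rw [if_neg (not_le.2 (sub_neg.2 h)), truncPow_of_neg _ (by linarith : x + M - b < 0), hYb,
      show x - (b - M) = x + M - b by ring]
    have hE : Real.exp (-lam * (x + M - b))
        = Real.exp (-lam * (x + M)) * Real.exp (lam * b) := by
      rw [← Real.exp_add]; congr 1; ring
    rw [hE]
    ring

theorem continuous_moment_kernel (M K lam : ℝ) (r : ℕ) : Continuous fun b : ℝ =>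
    lam ^ r * (K - max (b - M) 0) ^ r * Real.exp (lam * max (b - M) 0) := by fun_prop

section Pairing

variable {m : ℕ} {M K lam : ℝ} {ρ : Measure ℝ} {w : ℝ → ℝ}

theorem integral_gammaPDFReal_sub_mul (hm : 1 ≤ m) (hρ : ∀ᵐ b ∂ρ, b ∈ Icc 0 K)
    (hw : Integrable w ρ) {x : ℝ} (hx : 0 ≤ x) :
    ∫ b, gammaPDFReal m lam (x - max (b - M) 0) * w b ∂ρ
      = topPdf m K lam (storageMoment m M K lam ρ w) x
        - lam ^ m * Real.exp (-lam * (x + M)) *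
          ∫ b, truncPow (m - 1) (x + M - b) * Real.exp (lam * b) * w b ∂ρ := by
  simp_rw [gammaPDFReal_sub_eq (K := K) hm hx, sub_mul, topPdf, storageMoment]
  have hi : ∀ r : Fin m, Integrable (fun b => lam ^ (r : ℕ) * (K - max (b - M) 0) ^ (r : ℕ) *
      Real.exp (lam * max (b - M) 0) * w b) ρ := fun r =>
    integrable_continuous_mul hρ hw (continuous_moment_kernel M K lam r)
  have hi' : Integrable (fun b => truncPow (m - 1) (x + M - b) * Real.exp (lam * b) * w b) ρ :=
    integrable_mul_of_bound_Icc hρ hw (by fun_prop) (exists_bound_truncPow_mul_exp _ _ _ _)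
  have hterm : ∀ (b : ℝ), Real.exp (-lam * x) * (∑ r : Fin m, lam ^ (r : ℕ) *
        (K - max (b - M) 0) ^ (r : ℕ) * Real.exp (lam * max (b - M) 0) / ((r : ℕ)! : ℝ) *
        (lam ^ (m - (r : ℕ)) * ((x - K) ^ (m - (r : ℕ) - 1) / ((m - (r : ℕ) - 1)! : ℝ)))) * w b
      = Real.exp (-lam * x) * ∑ r : Fin m, (lam ^ (r : ℕ) *
        (K - max (b - M) 0) ^ (r : ℕ) * Real.exp (lam * max (b - M) 0) * w b) *
        (1 / ((r : ℕ)! : ℝ) *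
        (lam ^ (m - (r : ℕ)) * ((x - K) ^ (m - (r : ℕ) - 1) / ((m - (r : ℕ) - 1)! : ℝ)))) := by
    intro b
    rw [mul_assoc, Finset.sum_mul]
    congr 1
    exact Finset.sum_congr rfl fun r _ => by ring
  simp_rw [hterm, mul_assoc (lam ^ m * Real.exp (-lam * (x + M)))]
  rw [integral_sub, integral_const_mul, integral_const_mul, integral_finsetSum]
  · simp_rw [integral_mul_const]
    congr 2
    exact Finset.sum_congr rfl fun r _ => by ring
  · exact fun r _ => (hi r).mul_const _
  · exact (integrable_finsetSum _ fun r _ => (hi r).mul_const _).const_mul _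
  · exact hi'.const_mul _

/-- The survival function at `K - Y` is a combination of the same kernels `(K - Y) ^ r * exp (λ Y)`,
so the atom is governed by the same moments as the pdf. -/
theorem integral_erlangTail_mul (hρ : ∀ᵐ b ∂ρ, b ∈ Icc 0 K) (hw : Integrable w ρ) :
    ∫ b, erlangTail m lam (K - max (b - M) 0) * w b ∂ρ
      = fullMass m K lam (storageMoment m M K lam ρ w) := by
  have hi : ∀ r : Fin m, Integrable (fun b => lam ^ (r : ℕ) * (K - max (b - M) 0) ^ (r : ℕ) *
      Real.exp (lam * max (b - M) 0) * w b) ρ := fun r =>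
    integrable_continuous_mul hρ hw (continuous_moment_kernel M K lam r)
  have hterm : ∀ b, erlangTail m lam (K - max (b - M) 0) * w b
      = Real.exp (-lam * K) * ∑ r : Fin m, (lam ^ (r : ℕ) * (K - max (b - M) 0) ^ (r : ℕ) *
          Real.exp (lam * max (b - M) 0) * w b) * (1 / ((r : ℕ)! : ℝ)) := by
    intro b
    have hE : Real.exp (-lam * (K - max (b - M) 0))
        = Real.exp (-lam * K) * Real.exp (lam * max (b - M) 0) := by
      rw [← Real.exp_add]; congr 1; ring
    rw [erlangTail, ← Fin.sum_univ_eq_sum_range (fun t => (lam * (K - max (b - M) 0)) ^ t / (t ! : ℝ)),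
      hE, mul_assoc, mul_assoc, Finset.sum_mul, Finset.mul_sum]
    congr 1
    exact Finset.sum_congr rfl fun r _ => by rw [mul_pow]; ring
  simp_rw [hterm]
  rw [integral_const_mul, integral_finsetSum _ fun r _ => (hi r).mul_const _, fullMass]
  simp_rw [integral_mul_const, storageMoment, mul_one_div]

end Pairing

/-! ### The explicit pdf and the one-slot equation it solves -/

/-- The limiting pdf on `[0, K)` with coefficients `γ`: all stripes in one formula. -/
noncomputable def storagePdf (m l : ℕ) (M K lam : ℝ) (γ : Fin m → ℝ) (x : ℝ) : ℝ :=
  Real.exp (-lam * x) * ∑ r : Fin m, γ r / ((r : ℕ)! : ℝ) *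
    ((∑ q ∈ Finset.range (l + 1), lam ^ ((q + 1) * m - (r : ℕ)) * Real.exp (-lam * M * q) *
        truncPow ((q + 1) * m - (r : ℕ) - 1) (x - (K - q * M)))
      - ∑ q ∈ Finset.Icc 1 l, lam ^ (q * m) * Real.exp (-lam * M * q) *
        truncPow (q * m - 1) (x - (K - q * M)))

theorem sum_Icc_one_eq_sum_range (f : ℕ → ℝ) (n : ℕ) :
    ∑ q ∈ Finset.Icc 1 n, f q = ∑ q ∈ Finset.range n, f (q + 1) := by
  induction n with
  | zero => simp
  | succ n ih => rw [Finset.sum_Icc_succ_top (by omega), ih, Finset.sum_range_succ]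

/-- As `x` decreases, the truncated powers switch on one at a time at the knots `K - q M`; on stripe
`n` those with `q ≤ n` are active. -/
theorem storagePdf_eq_stripePdf {m l : ℕ} {M K lam : ℝ} (hM : 0 < M)
    (hK : K < ((l : ℝ) + 1) * M) (γ : Fin m → ℝ) {n : ℕ} {x : ℝ} (hx0 : 0 ≤ x)
    (hxl : K - ((n : ℝ) + 1) * M ≤ x) (hxr : x < K - n * M) :
    storagePdf m l M K lam γ x = stripePdf m M K lam γ n x := by
  have hnl : n ≤ l := by
    have h1 : (n : ℝ) * M < ((l : ℝ) + 1) * M := by linarith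
    have h2 : (n : ℝ) < (l : ℝ) + 1 := lt_of_mul_lt_mul_right h1 hM.le
    exact Nat.lt_succ_iff.1 (by exact_mod_cast h2)
  have hneg : ∀ q : ℕ, q ≤ n → x - (K - q * M) < 0 := fun q hq => by
    have : (q : ℝ) * M ≤ n * M := by gcongr
    linarith
  have hpos : ∀ q : ℕ, n < q → 0 ≤ x - (K - q * M) := fun q hq => by
    have : ((n : ℝ) + 1) * M ≤ q * M := by
      gcongr
      exact_mod_cast hq
    linarith
  unfold storagePdf stripePdf
  congr 1
  refine Finset.sum_congr rfl fun r _ => ?_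
  congr 2
  · rw [← Finset.sum_subset (Finset.range_mono (Nat.succ_le_succ hnl))]
    · refine Finset.sum_congr rfl fun q hq => ?_
      rw [truncPow_of_neg _ (hneg q (Nat.lt_succ_iff.1 (Finset.mem_range.1 hq))),
        show x - (K - q * M) = q * M + x - K by ring]
    · intro q _ hq
      rw [truncPow_of_nonneg _ (hpos q (by simpa using hq)), mul_zero]
  · rw [← Finset.sum_subset (Finset.Icc_subset_Icc_right hnl)]
    · refine Finset.sum_congr rfl fun q hq => ?_
      rw [truncPow_of_neg _ (hneg q (Finset.mem_Icc.1 hq).2),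
        show x - (K - q * M) = q * M + x - K by ring]
    · intro q hq hq'
      rw [truncPow_of_nonneg _ (hpos q _), mul_zero]
      simp only [Finset.mem_Icc] at hq hq'
      omega

@[fun_prop]
theorem measurable_storagePdf (m l : ℕ) (M K lam : ℝ) (γ : Fin m → ℝ) :
    Measurable (storagePdf m l M K lam γ) := by
  unfold storagePdf
  fun_prop

theorem integrableOn_exp_mul_truncPow {f : ℝ → ℝ} {K : ℝ} (hf : Measurable f)
    (hb : ∃ C, ∀ b ∈ Icc 0 K, |f b| ≤ C) (lam d : ℝ) (N : ℕ) :
    IntegrableOn (fun b => f b * (Real.exp (-lam * b) * truncPow N (b - d))) (Ioo 0 K) := by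
  refine integrable_mul_of_bound_Icc ((ae_restrict_mem measurableSet_Ioo).mono fun b h =>
    Ioo_subset_Icc_self h) ?_ hf hb
  obtain ⟨C, hC⟩ := exists_bound_Icc (f := fun b => Real.exp (-lam * b) * |b - d| ^ N)
    (by fun_prop) K
  refine Measure.integrableOn_of_bounded (M := C) (by simp) (by fun_prop) ?_
  refine (ae_restrict_mem measurableSet_Ioo).mono fun b h => le_trans ?_
    (hC b (Ioo_subset_Icc_self h))
  rw [Real.norm_eq_abs, abs_mul, abs_mul, abs_pow, abs_abs]
  gcongr
  exact abs_truncPow_le _ _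

section Linear

variable {m l : ℕ} {M K lam : ℝ}

theorem mul_storagePdf_eq (f : ℝ → ℝ) (γ : Fin m → ℝ) (b : ℝ) :
    f b * storagePdf m l M K lam γ b = ∑ r : Fin m, γ r / ((r : ℕ)! : ℝ) *
      ((∑ q ∈ Finset.range (l + 1), lam ^ ((q + 1) * m - (r : ℕ)) * Real.exp (-lam * M * q) *
        (f b * (Real.exp (-lam * b) * truncPow ((q + 1) * m - (r : ℕ) - 1) (b - (K - q * M)))))
      - ∑ q ∈ Finset.Icc 1 l, lam ^ (q * m) * Real.exp (-lam * M * q) *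
        (f b * (Real.exp (-lam * b) * truncPow (q * m - 1) (b - (K - q * M))))) := by
  unfold storagePdf
  rw [← mul_assoc, Finset.mul_sum]
  refine Finset.sum_congr rfl fun r _ => ?_
  rw [mul_left_comm, mul_sub, Finset.mul_sum, Finset.mul_sum]
  congr 2 <;> exact Finset.sum_congr rfl fun q _ => by ring

theorem integrableOn_mul_storagePdf {f : ℝ → ℝ} (hf : Measurable f)
    (hb : ∃ C, ∀ b ∈ Icc 0 K, |f b| ≤ C) (γ : Fin m → ℝ) :
    IntegrableOn (fun b => f b * storagePdf m l M K lam γ b) (Ioo 0 K) := by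
  simp_rw [mul_storagePdf_eq]
  refine integrable_finsetSum _ fun r _ => Integrable.const_mul (Integrable.sub
    (integrable_finsetSum _ fun q _ => ?_) (integrable_finsetSum _ fun q _ => ?_)) _
  all_goals exact (integrableOn_exp_mul_truncPow hf hb _ _ _).const_mul _

theorem integral_mul_storagePdf {f : ℝ → ℝ} (hf : Measurable f)
    (hb : ∃ C, ∀ b ∈ Icc 0 K, |f b| ≤ C) (γ : Fin m → ℝ) :
    ∫ b in Ioo 0 K, f b * storagePdf m l M K lam γ b = ∑ r : Fin m, γ r / ((r : ℕ)! : ℝ) *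
      ((∑ q ∈ Finset.range (l + 1), lam ^ ((q + 1) * m - (r : ℕ)) * Real.exp (-lam * M * q) *
        ∫ b in Ioo 0 K, f b * (Real.exp (-lam * b) *
          truncPow ((q + 1) * m - (r : ℕ) - 1) (b - (K - q * M))))
      - ∑ q ∈ Finset.Icc 1 l, lam ^ (q * m) * Real.exp (-lam * M * q) *
        ∫ b in Ioo 0 K, f b * (Real.exp (-lam * b) * truncPow (q * m - 1) (b - (K - q * M)))) := by
  simp_rw [mul_storagePdf_eq]
  have hi := fun N d => integrableOn_exp_mul_truncPow hf hb lam d N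
  have h1 := fun r : Fin m => integrable_finsetSum (μ := volume.restrict (Ioo 0 K))
    (Finset.range (l + 1))
    (f := fun q b => lam ^ ((q + 1) * m - (r : ℕ)) * Real.exp (-lam * M * q) *
        (f b * (Real.exp (-lam * b) * truncPow ((q + 1) * m - (r : ℕ) - 1) (b - (K - q * M)))))
    fun q _ => (hi _ _).const_mul _
  have h2 := integrable_finsetSum (μ := volume.restrict (Ioo 0 K)) (Finset.Icc 1 l)
    (f := fun q b => lam ^ (q * m) * Real.exp (-lam * M * q) *
        (f b * (Real.exp (-lam * b) * truncPow (q * m - 1) (b - (K - q * M)))))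
    fun q _ => (hi _ _).const_mul _
  rw [integral_finsetSum]
  swap
  · exact fun r _ => ((h1 r).sub h2).const_mul _
  refine Finset.sum_congr rfl fun r _ => ?_
  rw [integral_const_mul, integral_sub (h1 r) h2, integral_finsetSum _ fun q _ => (hi _ _).const_mul _,
    integral_finsetSum _ fun q _ => (hi _ _).const_mul _]
  simp_rw [integral_const_mul]

/-- The factor `exp (λ b)` cancels the exponential of the pdf and leaves convolutions of truncated
powers. -/
theorem integral_truncPow_mul_exp_mul_storagePdf (hm : 1 ≤ m) (hM : 0 ≤ M) (γ : Fin m → ℝ) (t : ℕ)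
    {c : ℝ} (hc : 0 ≤ c) :
    ∫ b in Ioo 0 K, truncPow t (c - b) * Real.exp (lam * b) * storagePdf m l M K lam γ b
      = -∑ r : Fin m, γ r / ((r : ℕ)! : ℝ) *
      ((∑ q ∈ Finset.range (l + 1), lam ^ ((q + 1) * m - (r : ℕ)) * Real.exp (-lam * M * q) *
        truncPow ((q + 1) * m - (r : ℕ) + t) (c - (K - q * M)))
      - ∑ q ∈ Finset.Icc 1 l, lam ^ (q * m) * Real.exp (-lam * M * q) *
        truncPow (q * m + t) (c - (K - q * M))) := by
  have key : ∀ (N q : ℕ), 1 ≤ N → ∫ b in Ioo 0 K, truncPow t (c - b) * Real.exp (lam * b) *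
      (Real.exp (-lam * b) * truncPow (N - 1) (b - (K - q * M)))
        = -truncPow (N + t) (c - (K - q * M)) := by
    intro N q hN
    have : ∀ b, truncPow t (c - b) * Real.exp (lam * b) *
        (Real.exp (-lam * b) * truncPow (N - 1) (b - (K - q * M)))
        = truncPow t (c - b) * truncPow (N - 1) (b - (K - q * M)) := by
      intro b
      have hE : Real.exp (lam * b) * Real.exp (-lam * b) = 1 := by
        rw [← Real.exp_add]; simp
      linear_combination truncPow t (c - b) * truncPow (N - 1) (b - (K - q * M)) * hE
    simp_rw [this]
    rw [integral_truncPow_mul_truncPow t (N - 1) hc (by have : 0 ≤ q * M := by positivity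
                                                        linarith),
      show t + (N - 1) + 1 = N + t by omega]
  rw [integral_mul_storagePdf (by fun_prop) (exists_bound_truncPow_mul_exp _ _ _ _),
    ← Finset.sum_neg_distrib]
  refine Finset.sum_congr rfl fun r _ => ?_
  have h1 : ∀ q : ℕ, 1 ≤ (q + 1) * m - (r : ℕ) := fun q => by
    have := r.2
    have : m ≤ (q + 1) * m := Nat.le_mul_of_pos_left m (by omega)
    omega
  rw [← mul_neg, neg_sub', ← Finset.sum_neg_distrib, ← Finset.sum_neg_distrib]
  congr 2
  · exact Finset.sum_congr rfl fun q _ => by rw [key _ _ (h1 q), mul_neg]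
  · refine Finset.sum_congr rfl fun q hq => ?_
    rw [key _ _ (Nat.mul_pos (Finset.mem_Icc.1 hq).1 hm), mul_neg]

/-- Under the integral, term `q` gains degree `m` and its knot moves down by `M`, so it becomes term
`q + 1`; term `l` drops out because its new knot is negative. The missing first terms come from
`topPdf` in the first sum and from the atom at `K` in the second. -/
theorem storagePdf_eq_topPdf_sub (hm : 1 ≤ m) (hM : 0 < M) (hK : K < ((l : ℝ) + 1) * M)
    (γ : Fin m → ℝ) {x : ℝ} (hx : 0 ≤ x) (hxK : x < K) :
    storagePdf m l M K lam γ x = topPdf m K lam γ x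
      - lam ^ m * Real.exp (-lam * (x + M)) *
        ((∫ b in Ioo 0 K, truncPow (m - 1) (x + M - b) * Real.exp (lam * b) *
            storagePdf m l M K lam γ b)
          + truncPow (m - 1) (x + M - K) * Real.exp (lam * K) * fullMass m K lam γ) := by
  have hE : Real.exp (lam * K) * Real.exp (-lam * K) = 1 := by
    rw [← Real.exp_add]; simp
  have hfull : truncPow (m - 1) (x + M - K) * Real.exp (lam * K) * fullMass m K lam γ
      = ∑ r : Fin m, γ r / ((r : ℕ)! : ℝ) * truncPow (m - 1) (x + M - K) := by
    rw [fullMass, ← Finset.sum_mul]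
    linear_combination truncPow (m - 1) (x + M - K) * (∑ r : Fin m, γ r / ((r : ℕ)! : ℝ)) * hE
  rw [integral_truncPow_mul_exp_mul_storagePdf hm hM.le γ _ (by linarith), hfull, storagePdf, topPdf,
    show -lam * (x + M) = -lam * x + -lam * M by ring, Real.exp_add,
    neg_add_eq_sub, ← Finset.sum_sub_distrib,
    show lam ^ m * (Real.exp (-lam * x) * Real.exp (-lam * M)) =
      Real.exp (-lam * x) * (lam ^ m * Real.exp (-lam * M)) by ring, mul_assoc, ← mul_sub,
    Finset.mul_sum _ _ (lam ^ m * Real.exp (-lam * M)), ← Finset.sum_sub_distrib]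
  congr 1
  refine Finset.sum_congr rfl fun r _ => ?_
  have hr : (r : ℕ) < m := r.2
  have hq1 : ∀ q : ℕ, m ≤ (q + 1) * m := fun q => Nat.le_mul_of_pos_left m (by omega)
  have hlast : 0 ≤ x + M - (K - l * M) := by linarith
  have hexp : ∀ q : ℕ, Real.exp (-lam * M * ((q + 1 : ℕ) : ℝ))
      = Real.exp (-lam * M) * Real.exp (-lam * M * q) := fun q => by
    rw [← Real.exp_add]; congr 1; push_cast; ring
  have harg : ∀ q : ℕ, x - (K - ((q + 1 : ℕ) : ℝ) * M) = x + M - (K - q * M) := fun q => by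
    push_cast; ring
  have hA : (∑ q ∈ Finset.range (l + 1), lam ^ ((q + 1) * m - (r : ℕ)) * Real.exp (-lam * M * q) *
        truncPow ((q + 1) * m - (r : ℕ) - 1) (x - (K - q * M)))
      = lam ^ (m - (r : ℕ)) * ((x - K) ^ (m - (r : ℕ) - 1) / ((m - (r : ℕ) - 1)! : ℝ))
        + lam ^ m * Real.exp (-lam * M) * ∑ q ∈ Finset.range (l + 1),
          lam ^ ((q + 1) * m - (r : ℕ)) * Real.exp (-lam * M * q) *
            truncPow ((q + 1) * m - (r : ℕ) + (m - 1)) (x + M - (K - q * M)) := by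
    rw [Finset.sum_range_succ', Finset.sum_range_succ _ l, truncPow_of_nonneg _ hlast, mul_zero,
      add_zero, Finset.mul_sum, add_comm]
    congr 1
    · have hx' : x - K < 0 := sub_neg.2 hxK
      simp [truncPow_of_neg _ hx']
    · refine Finset.sum_congr rfl fun q _ => ?_
      have h := hq1 q
      have e1 : (q + 1 + 1) * m - (r : ℕ) = m + ((q + 1) * m - r) := by
        rw [add_mul (q + 1)]; omega
      rw [hexp, harg, e1, show m + ((q + 1) * m - (r : ℕ)) - 1 = (q + 1) * m - r + (m - 1) by omega,
        pow_add]
      ring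
  have hB : (∑ q ∈ Finset.Icc 1 l, lam ^ (q * m) * Real.exp (-lam * M * q) *
        truncPow (q * m - 1) (x - (K - q * M)))
      = lam ^ m * Real.exp (-lam * M) * (truncPow (m - 1) (x + M - K) + ∑ q ∈ Finset.Icc 1 l,
          lam ^ (q * m) * Real.exp (-lam * M * q) *
            truncPow (q * m + (m - 1)) (x + M - (K - q * M))) := by
    have h0 : ∑ q ∈ Finset.range (l + 1), lam ^ (q * m) * Real.exp (-lam * M * q) *
            truncPow (q * m + (m - 1)) (x + M - (K - q * M))
        = truncPow (m - 1) (x + M - K) + ∑ q ∈ Finset.Icc 1 l,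
          lam ^ (q * m) * Real.exp (-lam * M * q) *
            truncPow (q * m + (m - 1)) (x + M - (K - q * M)) := by
      rw [Finset.sum_range_succ', sum_Icc_one_eq_sum_range, add_comm]
      simp
    rw [← h0, Finset.sum_range_succ _ l, truncPow_of_nonneg _ hlast, mul_zero, add_zero,
      sum_Icc_one_eq_sum_range, Finset.mul_sum]
    refine Finset.sum_congr rfl fun q _ => ?_
    rw [hexp, harg, show (q + 1) * m - 1 = q * m + (m - 1) by rw [add_mul]; omega, add_mul,
      one_mul, pow_add]
    ring
  rw [hA, hB]
  ring

end Linear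

/-! ### Mass and moments of the signed distributions; origin of the matrix -/

/-- The reference measure on `(0, K]` for the distribution of the stored energy. -/
noncomputable def storageBase (K : ℝ) : Measure ℝ := volume.restrict (Ioo 0 K) + Measure.dirac K

instance (K : ℝ) : IsFiniteMeasure (storageBase K) := by
  unfold storageBase; infer_instance

theorem ae_storageBase_mem_Icc {K : ℝ} (hK : 0 ≤ K) : ∀ᵐ b ∂(storageBase K), b ∈ Icc 0 K := by
  rw [storageBase, ae_add_measure_iff]
  refine ⟨(ae_restrict_mem measurableSet_Ioo).mono fun b h => Ioo_subset_Icc_self h, ?_⟩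
  rw [ae_dirac_eq]
  exact ⟨hK, le_rfl⟩

/-- The density with respect to `storageBase K` of the signed distribution with coefficients
`γ`. -/
noncomputable def storageWeight (m l : ℕ) (M K lam : ℝ) (γ : Fin m → ℝ) (b : ℝ) : ℝ :=
  if b < K then storagePdf m l M K lam γ b else fullMass m K lam γ

section Weight

variable {m l : ℕ} {M K lam : ℝ}

@[fun_prop]
theorem measurable_storageWeight (γ : Fin m → ℝ) : Measurable (storageWeight m l M K lam γ) :=
  Measurable.ite measurableSet_Iio (by fun_prop) measurable_const

theorem storageWeight_ae_eq (γ : Fin m → ℝ) :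
    storageWeight m l M K lam γ =ᵐ[volume.restrict (Ioo 0 K)] storagePdf m l M K lam γ :=
  (ae_restrict_mem measurableSet_Ioo).mono fun _ h => if_pos h.2

theorem integrable_storageWeight (γ : Fin m → ℝ) :
    Integrable (storageWeight m l M K lam γ) (storageBase K) := by
  refine Integrable.add_measure ?_ (integrable_dirac (by simp))
  have := integrableOn_mul_storagePdf (l := l) (M := M) (K := K) (lam := lam) (f := fun _ => 1)
    measurable_const ⟨1, by simp⟩ γ
  simp only [one_mul] at this
  exact this.congr (storageWeight_ae_eq γ).symm

theorem integral_mul_storageWeight {f : ℝ → ℝ} (hf : Measurable f)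
    (hb : ∃ C, ∀ b ∈ Icc 0 K, |f b| ≤ C) (γ : Fin m → ℝ) :
    ∫ b, f b * storageWeight m l M K lam γ b ∂(storageBase K)
      = (∫ b in Ioo 0 K, f b * storagePdf m l M K lam γ b) + f K * fullMass m K lam γ := by
  have hae : (fun b => f b * storageWeight m l M K lam γ b)
      =ᵐ[volume.restrict (Ioo 0 K)] fun b => f b * storagePdf m l M K lam γ b :=
    (storageWeight_ae_eq (l := l) (M := M) (lam := lam) γ).mono fun b h => by simp only [h]
  rw [storageBase, integral_add_measure, integral_congr_ae hae, integral_dirac]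
  · simp [storageWeight]
  · exact (integrableOn_mul_storagePdf hf hb γ).congr hae.symm
  · exact integrable_dirac enorm_lt_top

theorem integral_storageWeight (γ : Fin m → ℝ) :
    ∫ b, storageWeight m l M K lam γ b ∂(storageBase K)
      = (∫ b in Ioo 0 K, storagePdf m l M K lam γ b) + fullMass m K lam γ := by
  simpa using integral_mul_storageWeight (l := l) (M := M) (lam := lam) (f := fun _ => 1)
    measurable_const ⟨1, by simp⟩ γ

theorem exists_bound_indicator_mul {f : ℝ → ℝ} (hf : Continuous f) (S : Set ℝ) :
    ∃ C, ∀ b ∈ Icc 0 K, |S.indicator 1 b * f b| ≤ C := by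
  obtain ⟨C, hC⟩ := exists_bound_Icc hf K
  refine ⟨C, fun b hb => le_trans ?_ (hC b hb)⟩
  by_cases h : b ∈ S <;> simp [h]

/-- `L` separates the knots `K - q M` above `c` from those below. Each weighted truncated power
integrates to a partial exponential sum minus `exp (-λ K)`. The first sum has one term more than the
second, and the leftover constant cancels the atom; pairing equal `q` leaves a window of the
exponential series. -/
theorem integral_tail_storageWeight (hm : 1 ≤ m) (γ : Fin m → ℝ) {c : ℝ} {L : ℕ}
    (hL : L ≤ l) (hc : 0 ≤ c) (hM : 0 ≤ M) (hlo : ∀ q : ℕ, q ≤ L → c ≤ K - q * M)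
    (hhi : ∀ q : ℕ, L < q → q ≤ l → K - q * M ≤ c) :
    ∫ b, (Ici c).indicator 1 b * storageWeight m l M K lam γ b ∂(storageBase K)
      = ∑ r : Fin m, γ r / ((r : ℕ)! : ℝ) * ∑ q ∈ Finset.range (L + 1),
          Real.exp (-lam * M * q) * (Real.exp (-lam * c) *
            ∑ t ∈ Finset.Ico (q * m) ((q + 1) * m - (r : ℕ)),
              (lam * (c - (K - q * M))) ^ t / (t ! : ℝ)) := by
  have hcK : c ≤ K := by simpa using hlo 0 (Nat.zero_le _)
  have hfm : Measurable ((Ici c).indicator (1 : ℝ → ℝ)) := measurable_one.indicator measurableSet_Ici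
  have hfb : ∃ C, ∀ b ∈ Icc 0 K, |(Ici c).indicator (1 : ℝ → ℝ) b| ≤ C := by
    simpa using exists_bound_indicator_mul (K := K) (f := fun _ => 1) continuous_const (Ici c)
  rw [integral_mul_storageWeight hfm hfb, integral_mul_storagePdf hfm hfb, fullMass,
    indicator_of_mem (show K ∈ Ici c from hcK), Pi.one_apply, one_mul, Finset.mul_sum,
    ← Finset.sum_add_distrib]
  refine Finset.sum_congr rfl fun r _ => ?_
  set S : ℕ → ℕ → ℝ := fun q n => Real.exp (-lam * M * q) * (Real.exp (-lam * c) *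
    ∑ t ∈ Finset.range n, (lam * (c - (K - q * M))) ^ t / (t ! : ℝ)) - Real.exp (-lam * K)
    with hS
  have key : ∀ q N : ℕ, q ≤ L → 1 ≤ N → lam ^ N * Real.exp (-lam * M * q) *
      (∫ b in Ioo 0 K, (Ici c).indicator 1 b * (Real.exp (-lam * b) *
        truncPow (N - 1) (b - (K - q * M)))) = S q N := by
    intro q N hq hN
    obtain ⟨n, rfl⟩ : ∃ n, N = n + 1 := ⟨N - 1, by omega⟩
    have h := integral_exp_mul_truncPow lam n hc (hlo q hq)
      (show K - q * M ≤ K by have : 0 ≤ q * M := by positivity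
                             linarith)
    have hE : Real.exp (-lam * M * q) * Real.exp (-lam * (K - q * M)) = Real.exp (-lam * K) := by
      rw [← Real.exp_add]; congr 1; ring
    rw [Nat.add_sub_cancel, mul_right_comm, h, hS, ← hE]
    ring
  have key0 : ∀ q N : ℕ, L < q → q ≤ l → lam ^ N * Real.exp (-lam * M * q) *
      (∫ b in Ioo 0 K, (Ici c).indicator 1 b * (Real.exp (-lam * b) *
        truncPow (N - 1) (b - (K - q * M)))) = 0 := by
    intro q N hq hql
    rw [integral_exp_mul_truncPow_of_lt _ _ (hhi q hq hql), mul_zero]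
  have hpos : ∀ q : ℕ, 1 ≤ (q + 1) * m - (r : ℕ) := fun q => by
    have := r.2
    have : m ≤ (q + 1) * m := Nat.le_mul_of_pos_left m (by omega)
    omega
  rw [← Finset.sum_subset (Finset.range_mono (Nat.succ_le_succ hL)),
    ← Finset.sum_subset (Finset.Icc_subset_Icc_right hL)]
  · rw [Finset.sum_congr rfl fun q hq => key q _ (Nat.lt_succ_iff.1 (Finset.mem_range.1 hq)) (hpos q),
      Finset.sum_congr rfl fun q hq => key q (q * m) (Finset.mem_Icc.1 hq).2
        (Nat.mul_pos (Finset.mem_Icc.1 hq).1 hm)]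
    -- Extending the sum to `q = 0` adds an empty partial sum minus `exp (-λ K)`, which accounts for
    -- the atom.
    have h0 : ∑ q ∈ Finset.Icc 1 L, S q (q * m)
        = ∑ q ∈ Finset.range (L + 1), S q (q * m) + Real.exp (-lam * K) := by
      rw [sum_Icc_one_eq_sum_range, Finset.sum_range_succ']
      simp [hS]
    rw [h0, sub_add_eq_sub_sub, ← Finset.sum_sub_distrib]
    have h1 : ∀ q, S q ((q + 1) * m - (r : ℕ)) - S q (q * m) = Real.exp (-lam * M * q) *
        (Real.exp (-lam * c) * ∑ t ∈ Finset.Ico (q * m) ((q + 1) * m - (r : ℕ)),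
              (lam * (c - (K - q * M))) ^ t / (t ! : ℝ)) := by
      intro q
      rw [Finset.sum_Ico_eq_sub _ (by rw [add_mul]; have := r.2; omega)]
      simp only [hS]
      ring
    simp_rw [h1]
    ring
  · intro q hq hq'
    simp only [Finset.mem_Icc] at hq hq'
    exact key0 q _ (by omega) hq.2
  · intro q hq hq'
    simp only [Finset.mem_range] at hq hq'
    exact key0 q _ (by omega) (by omega)

/-- The atom supplies the term `q = 0` of the second sum. It carries a plain power instead of
`truncPow`, since for `K = M` and `t = 0` it still contributes with factor 1. -/
theorem integral_truncPow_mul_exp_add_fullMass (hm : 1 ≤ m) (hM : 0 ≤ M)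
    (hlo : (l : ℝ) * M ≤ K) (hhi : K ≤ ((l : ℝ) + 1) * M) (hl : 1 ≤ l) (γ : Fin m → ℝ) (t : ℕ) :
    (∫ b in Ioo 0 K, truncPow t (M - b) * Real.exp (lam * b) * storagePdf m l M K lam γ b)
        + (M - K) ^ t / (t ! : ℝ) * Real.exp (lam * K) * fullMass m K lam γ
      = -∑ r : Fin m, γ r / ((r : ℕ)! : ℝ) * ∑ q ∈ Finset.range l,
          lam ^ (q * m) * Real.exp (-lam * M * q) * (lam ^ (m - (r : ℕ)) *
            (((q : ℝ) + 1) * M - K) ^ ((q + 1) * m - (r : ℕ) + t)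
                / (((q + 1) * m - (r : ℕ) + t)! : ℝ)
              - (((q : ℝ) + 1) * M - K) ^ (q * m + t) / ((q * m + t)! : ℝ)) := by
  obtain ⟨k, rfl⟩ : ∃ k, l = k + 1 := ⟨l - 1, by omega⟩
  have hE : Real.exp (lam * K) * Real.exp (-lam * K) = 1 := by
    rw [← Real.exp_add]; simp
  have hfull : (M - K) ^ t / (t ! : ℝ) * Real.exp (lam * K) * fullMass m K lam γ
      = ∑ r : Fin m, γ r / ((r : ℕ)! : ℝ) * ((M - K) ^ t / (t ! : ℝ)) := by
    rw [fullMass, ← Finset.sum_mul]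
    linear_combination (M - K) ^ t / (t ! : ℝ) * (∑ r : Fin m, γ r / ((r : ℕ)! : ℝ)) * hE
  rw [integral_truncPow_mul_exp_mul_storagePdf hm hM γ t hM, hfull, neg_add_eq_sub,
    ← Finset.sum_sub_distrib, ← Finset.sum_neg_distrib]
  refine Finset.sum_congr rfl fun r _ => ?_
  have hr : (r : ℕ) < m := r.2
  have hlast : 0 ≤ M - (K - ((k + 1 : ℕ) : ℝ) * M) := by linarith
  have htp : ∀ q n : ℕ, q < k + 1 → n ≠ 0 → truncPow n (M - (K - q * M))
      = (((q : ℝ) + 1) * M - K) ^ n / (n ! : ℝ) := fun q n hq hn => by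
    have h1 : ((q : ℝ) + 1) * M ≤ ((k + 1 : ℕ) : ℝ) * M := by
      gcongr
      exact_mod_cast hq
    rw [show M - (K - q * M) = ((q : ℝ) + 1) * M - K by ring,
      truncPow_of_nonpos hn (by linarith)]
  have hA : ∑ q ∈ Finset.range (k + 1 + 1), lam ^ ((q + 1) * m - (r : ℕ)) *
        Real.exp (-lam * M * q) * truncPow ((q + 1) * m - (r : ℕ) + t) (M - (K - q * M))
      = ∑ q ∈ Finset.range (k + 1), lam ^ (q * m) * Real.exp (-lam * M * q) * (lam ^ (m - (r : ℕ)) *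
            (((q : ℝ) + 1) * M - K) ^ ((q + 1) * m - (r : ℕ) + t)
                / (((q + 1) * m - (r : ℕ) + t)! : ℝ)) := by
    rw [Finset.sum_range_succ, truncPow_of_nonneg _ hlast, mul_zero, add_zero]
    refine Finset.sum_congr rfl fun q hq => ?_
    have e1 : (q + 1) * m - (r : ℕ) = q * m + (m - r) := by rw [add_mul]; omega
    rw [htp q _ (Finset.mem_range.1 hq) (by omega), e1, pow_add]
    ring
  have hB : ∑ q ∈ Finset.Icc 1 (k + 1), lam ^ (q * m) *
        Real.exp (-lam * M * q) * truncPow (q * m + t) (M - (K - q * M)) + (M - K) ^ t / (t ! : ℝ)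
      = ∑ q ∈ Finset.range (k + 1), lam ^ (q * m) * Real.exp (-lam * M * q) *
          ((((q : ℝ) + 1) * M - K) ^ (q * m + t) / ((q * m + t)! : ℝ)) := by
    rw [Finset.sum_Icc_succ_top (by omega), truncPow_of_nonneg _ hlast, mul_zero, add_zero,
      sum_Icc_one_eq_sum_range, Finset.sum_range_succ' _ k]
    congr 1
    · refine Finset.sum_congr rfl fun q hq => ?_
      have : 0 < (q + 1) * m := Nat.mul_pos (by omega) hm
      rw [htp (q + 1) _ (by simpa using hq) (by omega)]
    · simp
  simp_rw [mul_sub, Finset.sum_sub_distrib, mul_sub]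
  rw [hA, ← hB]
  ring

/-- Split at `b = M`: below, the kernel is the constant `(λ K) ^ s`; above, `K - (b - M) = (M - b) +
K` is expanded binomially. -/
theorem storageMoment_storageWeight (hm : 1 ≤ m) (hM : 0 ≤ M) (hK : 0 < K)
    (hlo : (l : ℝ) * M ≤ K) (hhi : K ≤ ((l : ℝ) + 1) * M) (hl : 1 ≤ l) (γ : Fin m → ℝ) (s : Fin m) :
    storageMoment m M K lam (storageBase K) (storageWeight m l M K lam γ) s
      = (lam * K) ^ (s : ℕ) * ((∫ b, storageWeight m l M K lam γ b ∂(storageBase K))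
          - ∫ b, (Ici M).indicator 1 b * storageWeight m l M K lam γ b ∂(storageBase K))
        - (K * lam) ^ (s : ℕ) * ∑ t ∈ Finset.range ((s : ℕ) + 1),
          ((s : ℕ).choose t : ℝ) * (K ^ t)⁻¹ * (t ! : ℝ) * (Real.exp (-lam * M) *
            ∑ r : Fin m, γ r / ((r : ℕ)! : ℝ) * ∑ q ∈ Finset.range l,
              lam ^ (q * m) * Real.exp (-lam * M * q) * (lam ^ (m - (r : ℕ)) *
                (((q : ℝ) + 1) * M - K) ^ ((q + 1) * m - (r : ℕ) + t)
                    / (((q + 1) * m - (r : ℕ) + t)! : ℝ)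
                  - (((q : ℝ) + 1) * M - K) ^ (q * m + t) / ((q * m + t)! : ℝ))) := by
  have hρ := ae_storageBase_mem_Icc hK.le
  have hw := integrable_storageWeight (l := l) (M := M) (K := K) (lam := lam) γ
  have hMK : M ≤ K := by
    have : 1 * M ≤ (l : ℝ) * M := by
      gcongr
      exact_mod_cast hl
    linarith
  have hH := integral_truncPow_mul_exp_add_fullMass (lam := lam) hm hM hlo hhi hl γ
  set w := storageWeight m l M K lam γ with hwdef
  set H : ℕ → ℝ := fun t => ∫ b, (Ici M).indicator 1 b *
    ((M - b) ^ t / (t ! : ℝ) * Real.exp (lam * b)) * w b ∂(storageBase K) with hHdef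
  have hmeas : ∀ t : ℕ, Measurable fun b : ℝ => (Ici M).indicator (1 : ℝ → ℝ) b *
      ((M - b) ^ t / (t ! : ℝ) * Real.exp (lam * b)) := fun t =>
    (measurable_one.indicator measurableSet_Ici).mul (by fun_prop)
  have hbd : ∀ t : ℕ, ∃ C, ∀ b ∈ Icc 0 K, |(Ici M).indicator (1 : ℝ → ℝ) b *
      ((M - b) ^ t / (t ! : ℝ) * Real.exp (lam * b))| ≤ C := fun t =>
    exists_bound_indicator_mul (by fun_prop) _
  have hHeq : ∀ t, H t = (∫ b in Ioo 0 K, truncPow t (M - b) * Real.exp (lam * b) *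
      storagePdf m l M K lam γ b)
        + (M - K) ^ t / (t ! : ℝ) * Real.exp (lam * K) * fullMass m K lam γ := by
    intro t
    rw [hHdef]
    simp only [hwdef]
    rw [integral_mul_storageWeight (hmeas t) (hbd t)]
    congr 1
    · refine integral_congr_ae ?_
      -- For `t = 0` the indicator of `Ici M` and the cutoff in `truncPow` disagree at `b = M`, a
      -- null set.
      have : ∀ᵐ b : ℝ ∂(volume.restrict (Ioo 0 K)), b ≠ M :=
        ae_restrict_of_ae (by simp [ae_iff])
      filter_upwards [this] with b hb
      congr 1
      rcases lt_or_gt_of_ne hb with h | h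
      · rw [truncPow_of_nonneg _ (by linarith), indicator_of_notMem (by simpa using h)]
        simp
      · rw [truncPow_of_neg _ (by linarith), indicator_of_mem (by simpa using h.le)]
        simp
    · rw [indicator_of_mem (show K ∈ Ici M from hMK)]
      simp
  have hpt : ∀ b, lam ^ (s : ℕ) * (K - max (b - M) 0) ^ (s : ℕ) * Real.exp (lam * max (b - M) 0) * w b
      = (lam * K) ^ (s : ℕ) * (w b - (Ici M).indicator 1 b * w b)
        + ∑ t ∈ Finset.range ((s : ℕ) + 1), ((K * lam) ^ (s : ℕ) * (((s : ℕ).choose t : ℝ) *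
          (K ^ t)⁻¹ * (t ! : ℝ) * Real.exp (-lam * M))) * ((Ici M).indicator 1 b *
            ((M - b) ^ t / (t ! : ℝ) * Real.exp (lam * b)) * w b) := by
    intro b
    by_cases h : b ∈ Ici M
    · have hb : M ≤ b := h
      rw [max_eq_left (sub_nonneg.2 hb), indicator_of_mem h, Pi.one_apply,
        show K - (b - M) = (M - b) + K by ring, add_pow, Finset.mul_sum, Finset.sum_mul,
        Finset.sum_mul, one_mul, sub_self, mul_zero, zero_add]
      refine Finset.sum_congr rfl fun t ht => ?_
      have hts : t ≤ (s : ℕ) := Nat.lt_succ_iff.1 (Finset.mem_range.1 ht)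
      have hE : Real.exp (lam * (b - M)) = Real.exp (-lam * M) * Real.exp (lam * b) := by
        rw [← Real.exp_add]; congr 1; ring
      have h1 : (t ! : ℝ) ≠ 0 := by positivity
      rw [hE, mul_pow, ← pow_sub_mul_pow K hts]
      field_simp
    · have hb : b < M := not_le.1 h
      rw [max_eq_right (by linarith), indicator_of_notMem h]
      simp [mul_pow]
  have hwI : Integrable (fun b => (Ici M).indicator 1 b * w b) (storageBase K) :=
    integrable_mul_of_bound_Icc hρ hw (measurable_one.indicator measurableSet_Ici)
      (by simpa using exists_bound_indicator_mul (K := K) (f := fun _ => 1) continuous_const (Ici M))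
  have hHi := fun t => integrable_mul_of_bound_Icc hρ hw (hmeas t) (hbd t)
  have hd : Integrable (fun b => (lam * K) ^ (s : ℕ) * (w b - (Ici M).indicator 1 b * w b))
      (storageBase K) := (hw.sub hwI).const_mul _
  unfold storageMoment
  simp_rw [hpt]
  rw [integral_add hd (integrable_finsetSum _ fun t _ => (hHi t).const_mul _),
    integral_const_mul, integral_sub hw hwI, integral_finsetSum _ fun t _ => (hHi t).const_mul _,
    sub_eq_add_neg _ ((K * lam) ^ (s : ℕ) * _), Finset.mul_sum, ← Finset.sum_neg_distrib]
  congr 1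
  refine Finset.sum_congr rfl fun t _ => ?_
  have e := (hHeq t).trans (hH t)
  rw [integral_const_mul]
  change _ * H t = _
  rw [e]
  ring

/-- With total mass `T` and mass `Q` on `[M, K]`, the moment is `(λ K) ^ s * (T - Q)` minus a
binomial sum. Subtracting it from `T` leaves `T`, `Q` and that sum with the prefactors of the three
lines of `coeffMatrix`. As `γ` is arbitrary, the identity serves both existence and uniqueness. -/
theorem coeffMatrix_mulVec (hm : 1 ≤ m) (hM : 0 ≤ M) (hK : 0 < K)
    (hlo : (l : ℝ) * M ≤ K) (hhi : K ≤ ((l : ℝ) + 1) * M) (hl : 1 ≤ l) (γ : Fin m → ℝ) (s : Fin m) :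
    (coeffMatrix m l M K lam *ᵥ γ) s
      = (∫ b, storageWeight m l M K lam γ b ∂(storageBase K))
        - storageMoment m M K lam (storageBase K) (storageWeight m l M K lam γ) s := by
  have hqM : ∀ q n : ℕ, q ≤ n → (q : ℝ) * M ≤ n * M := fun q n h => by gcongr
  have hT : ∫ b, storageWeight m l M K lam γ b ∂(storageBase K)
      = ∑ r : Fin m, γ r / ((r : ℕ)! : ℝ) * ∑ q ∈ Finset.range (l + 1),
          Real.exp (-lam * M * q) * ∑ t ∈ Finset.Ico (q * m) ((q + 1) * m - (r : ℕ)),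
              (lam * ((q : ℝ) * M - K)) ^ t / (t ! : ℝ) := by
    have h := integral_tail_storageWeight (lam := lam) (K := K) hm γ (c := 0) (le_refl l) le_rfl hM
      (fun q hq => by linarith [hqM q l hq]) (fun q h1 h2 => by omega)
    have h0 : ∀ᵐ b ∂(storageBase K), storageWeight m l M K lam γ b
        = (Ici 0).indicator 1 b * storageWeight m l M K lam γ b :=
      (ae_storageBase_mem_Icc hK.le).mono fun b hb => by
        rw [indicator_of_mem (show b ∈ Ici (0 : ℝ) from hb.1)]; simp
    rw [integral_congr_ae h0, h]
    simp [sub_sub_eq_add_sub]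
  have hQ : ∫ b, (Ici M).indicator 1 b * storageWeight m l M K lam γ b ∂(storageBase K)
      = ∑ r : Fin m, γ r / ((r : ℕ)! : ℝ) * ∑ q ∈ Finset.range l,
          Real.exp (-lam * M * ((q : ℝ) + 1)) * ∑ t ∈ Finset.Ico (q * m) ((q + 1) * m - (r : ℕ)),
              (lam * (((q : ℝ) + 1) * M - K)) ^ t / (t ! : ℝ) := by
    have h := integral_tail_storageWeight (lam := lam) (K := K) hm γ (c := M) (L := l - 1)
      (Nat.sub_le l 1) hM hM
      (fun q hq => by
        have := hqM (q + 1) l (by omega)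
        push_cast at this
        linarith)
      (fun q h1 h2 => by
        have : q = l := by omega
        rw [this]; linarith)
    rw [h, Nat.sub_add_cancel hl]
    refine Finset.sum_congr rfl fun r _ => ?_
    congr 1
    refine Finset.sum_congr rfl fun q _ => ?_
    rw [← mul_assoc, ← Real.exp_add, show M - (K - q * M) = ((q : ℝ) + 1) * M - K by ring,
      show -lam * M * q + -lam * M = -lam * M * ((q : ℝ) + 1) by ring]
  rw [storageMoment_storageWeight hm hM hK hlo hhi hl, hT, hQ]
  have h3 : ∑ t ∈ Finset.range ((s : ℕ) + 1),
          ((s : ℕ).choose t : ℝ) * (K ^ t)⁻¹ * (t ! : ℝ) * (Real.exp (-lam * M) *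
            ∑ r : Fin m, γ r / ((r : ℕ)! : ℝ) * ∑ q ∈ Finset.range l,
              lam ^ (q * m) * Real.exp (-lam * M * q) * (lam ^ (m - (r : ℕ)) *
                (((q : ℝ) + 1) * M - K) ^ ((q + 1) * m - (r : ℕ) + t)
                    / (((q + 1) * m - (r : ℕ) + t)! : ℝ)
                  - (((q : ℝ) + 1) * M - K) ^ (q * m + t) / ((q * m + t)! : ℝ)))
      = ∑ r : Fin m, γ r / ((r : ℕ)! : ℝ) * ∑ t ∈ Finset.range ((s : ℕ) + 1),
        ((s : ℕ).choose t : ℝ) * (K ^ t)⁻¹ * (t ! : ℝ) *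
          ∑ q ∈ Finset.range l, lam ^ (q * m) * Real.exp (-lam * M * ((q : ℝ) + 1)) *
            (lam ^ (m - (r : ℕ)) *
                (((q : ℝ) + 1) * M - K) ^ ((q + 1) * m - (r : ℕ) + t)
                / (((q + 1) * m - (r : ℕ) + t)! : ℝ)
              - (((q : ℝ) + 1) * M - K) ^ (q * m + t) / ((q * m + t)! : ℝ)) := by
    simp_rw [Finset.mul_sum]
    rw [Finset.sum_comm]
    refine Finset.sum_congr rfl fun r _ => Finset.sum_congr rfl fun t _ =>
      Finset.sum_congr rfl fun q _ => ?_
    rw [show -lam * M * ((q : ℝ) + 1) = -lam * M + -lam * M * q by ring, Real.exp_add]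
    ring
  rw [h3, Finset.mul_sum, ← Finset.sum_sub_distrib, Finset.mul_sum, ← Finset.sum_sub_distrib,
    ← Finset.sum_sub_distrib]
  unfold Matrix.mulVec dotProduct coeffMatrix
  refine Finset.sum_congr rfl fun r _ => ?_
  rw [mul_pow, mul_pow]
  ring

end Weight

/-! ### One slot under Gamma harvesting -/

section GammaHarvest

variable {m : ℕ} {lam : ℝ}

theorem exists_bound_gammaPDFReal (hm : 1 ≤ m) (lam K : ℝ) :
    ∃ C, ∀ v ≤ K, |gammaPDFReal m lam v| ≤ C := by
  obtain ⟨C, hC⟩ := exists_bound_Icc (f := fun u : ℝ =>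
    lam ^ m * Real.exp (-lam * u) * (u ^ (m - 1) / ((m - 1)! : ℝ))) (by fun_prop) K
  refine ⟨max C 0, fun v hv => ?_⟩
  rw [gammaPDFReal_nat hm]
  split_ifs with h
  · exact (hC v ⟨h, hv⟩).trans (le_max_left _ _)
  · simp

theorem gammaMeasure_Iio_zero (a r : ℝ) : gammaMeasure a r (Iio 0) = 0 := by
  rw [gammaMeasure, withDensity_apply _ measurableSet_Iio]
  exact lintegral_gammaPDF_of_nonpos le_rfl

theorem ae_gammaMeasure_nonneg (a r : ℝ) : ∀ᵐ x ∂(gammaMeasure a r), 0 ≤ x := by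
  rw [ae_iff]
  simp only [not_le]
  exact gammaMeasure_Iio_zero a r

theorem gammaMeasure_real_Ici (hm : 1 ≤ m) (hlam : 0 < lam) {c : ℝ} (hc : 0 ≤ c) :
    (gammaMeasure m lam).real (Ici c) = erlangTail m lam c := by
  have hm' : (0 : ℝ) < m := by exact_mod_cast hm
  have := isProbabilityMeasure_gammaMeasure hm' hlam
  have h1 : gammaMeasure m lam (Iio c) = ENNReal.ofReal (1 - erlangTail m lam c) := by
    have hu : Iio c = Iio 0 ∪ Ico 0 c := (Iio_union_Ico_eq_Iio hc).symm
    have h2 : gammaMeasure m lam (Iio c) = gammaMeasure m lam (Ico 0 c) := by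
      refine le_antisymm ?_ (measure_mono Ico_subset_Iio_self)
      rw [hu]
      refine (measure_union_le _ _).trans ?_
      rw [gammaMeasure_Iio_zero, zero_add]
    have h3 := integral_gammaPDFReal hm lam le_rfl hc
    simp only [sub_zero] at h3
    rw [h2, gammaMeasure, withDensity_apply _ measurableSet_Ico, ← h3,
      setLIntegral_congr (Ioo_ae_eq_Ico (a := (0 : ℝ)) (b := c)).symm,
      ofReal_integral_eq_lintegral_ofReal]
    · rfl
    · obtain ⟨C, hC⟩ := exists_bound_gammaPDFReal hm lam c
      exact Measure.integrableOn_of_bounded (M := C) (by simp)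
        (measurable_gammaPDFReal _ _).aestronglyMeasurable
        ((ae_restrict_mem measurableSet_Ioo).mono fun v hv => hC v hv.2.le)
    · exact ae_of_all _ fun v => gammaPDFReal_nonneg hm' hlam v
  have h4 : erlangTail m lam c ≤ 1 := by
    rw [← erlangTail_zero hm lam]; exact erlangTail_antitone hm hlam le_rfl hc
  rw [← compl_Iio, probReal_compl_eq_one_sub measurableSet_Iio, measureReal_def, h1,
    ENNReal.toReal_ofReal (by linarith)]
  ring

theorem erlangTail_pos (hm : 1 ≤ m) (hlam : 0 < lam) {c : ℝ} (hc : 0 ≤ c) :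
    0 < erlangTail m lam c := by
  refine mul_pos (Real.exp_pos _) (Finset.sum_pos' (fun t _ => by positivity)
    ⟨0, Finset.mem_range.2 hm, by simp⟩)

theorem gammaMeasure_Ici_ne_zero (hm : 1 ≤ m) (hlam : 0 < lam) {c : ℝ} (hc : 0 ≤ c) :
    gammaMeasure m lam (Ici c) ≠ 0 := by
  intro h
  have h1 := gammaMeasure_real_Ici hm hlam hc
  rw [measureReal_def, h, ENNReal.toReal_zero] at h1
  exact (erlangTail_pos hm hlam hc).ne h1

@[fun_prop]
theorem measurable_gammaPDF (a r : ℝ) : Measurable (gammaPDF a r) :=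
  (measurable_gammaPDFReal a r).ennreal_ofReal

/-- Split the harvest at `K - Y`: below it the next level is `Y + x`, with the shifted Gamma
density; from there on the buffer is full. -/
theorem gammaMeasure_bestEffortStep_preimage {a r M K b : ℝ} {S : Set ℝ} (hS : MeasurableSet S) :
    gammaMeasure a r (bestEffortStep M K b ⁻¹' S)
      = (∫⁻ u in S ∩ Ioo 0 K, gammaPDF a r (u - max (b - M) 0))
        + S.indicator 1 K * gammaMeasure a r (Ici (K - max (b - M) 0)) := by
  set Y := max (b - M) 0 with hY
  have hY0 : 0 ≤ Y := le_max_right _ _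
  rw [← measure_inter_add_sdiff _ (measurableSet_Iio (a := K - Y))]
  congr 1
  · have h1 : bestEffortStep M K b ⁻¹' S ∩ Iio (K - Y) = (fun x => x + Y) ⁻¹' (S ∩ Iio K) := by
      ext x
      simp only [mem_inter_iff, mem_preimage, mem_Iio, bestEffortStep, ← hY]
      constructor
      · rintro ⟨h2, h3⟩
        rw [min_eq_left (by linarith), add_comm] at h2
        exact ⟨h2, by linarith⟩
      · rintro ⟨h2, h3⟩
        rw [min_eq_left (by linarith), add_comm Y]
        exact ⟨h2, by linarith⟩
    have hT : MeasurableSet (S ∩ Iio K) := hS.inter measurableSet_Iio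
    have hT' : MeasurableSet ((fun x => x + Y) ⁻¹' (S ∩ Iio K)) := (measurable_add_const Y) hT
    rw [h1, gammaMeasure, withDensity_apply _ hT', ← lintegral_indicator hT',
      ← lintegral_indicator (hS.inter measurableSet_Ioo),
      ← lintegral_sub_right_eq_self _ Y]
    refine lintegral_congr_ae ?_
    -- `Ioo 0 K` omits the level 0, which is reached when `Y = 0` and the harvest is 0.
    have h0 : ∀ᵐ u : ℝ, u ≠ 0 := by simp [ae_iff]
    filter_upwards [h0] with u hu
    by_cases hu0 : u < 0
    · have : u ∉ S ∩ Ioo 0 K := fun h => absurd h.2.1 (not_lt.2 hu0.le)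
      rw [indicator_of_notMem this]
      refine indicator_apply_eq_zero.2 fun _ => gammaPDF_of_neg (by linarith)
    · have hu1 : 0 < u := lt_of_le_of_ne (not_lt.1 hu0) hu.symm
      have hiff : u - Y ∈ (fun x => x + Y) ⁻¹' (S ∩ Iio K) ↔ u ∈ S ∩ Ioo 0 K := by
        simp [hu1]
      by_cases hm : u ∈ S ∩ Ioo 0 K
      · rw [indicator_of_mem hm, indicator_of_mem (hiff.2 hm)]
      · rw [indicator_of_notMem hm, indicator_of_notMem (mt hiff.1 hm)]
  · by_cases hK : K ∈ S
    · have h1 : bestEffortStep M K b ⁻¹' S \ Iio (K - Y) = Ici (K - Y) := by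
        ext x
        simp only [Set.mem_sdiff, mem_preimage, mem_Iio, not_lt, mem_Ici, bestEffortStep, ← hY]
        refine and_iff_right_of_imp fun h => ?_
        rwa [min_eq_right (by linarith)]
      rw [h1, indicator_of_mem hK, Pi.one_apply, one_mul]
    · have h1 : bestEffortStep M K b ⁻¹' S \ Iio (K - Y) = ∅ := by
        ext x
        simp only [Set.mem_sdiff, mem_preimage, mem_Iio, not_lt, bestEffortStep, ← hY,
          mem_empty_iff_false, iff_false, not_and]
        intro h2 h3
        rw [min_eq_right (by linarith)] at h2
        exact hK h2
      rw [h1, indicator_of_notMem hK, measure_empty, zero_mul]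

end GammaHarvest

/-! ### Pdf, atom and linear system of a stationary law -/

section Stationary

variable {a r M K : ℝ} {ν : Measure ℝ}

theorem stationary_apply [SFinite ν] [SFinite (gammaMeasure a r)]
    (hν : (ν.prod (gammaMeasure a r)).map (fun p : ℝ × ℝ => bestEffortStep M K p.1 p.2) = ν)
    {S : Set ℝ} (hS : MeasurableSet S) :
    ν S = (∫⁻ u in S ∩ Ioo 0 K, ∫⁻ b, gammaPDF a r (u - max (b - M) 0) ∂ν)
        + S.indicator 1 K * ∫⁻ b, gammaMeasure a r (Ici (K - max (b - M) 0)) ∂ν := by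
  have hstep := measurable_bestEffortStep M K
  have hj : Measurable fun p : ℝ × ℝ => gammaPDF a r (p.2 - max (p.1 - M) 0) := by fun_prop
  conv_lhs => rw [← hν]
  rw [Measure.map_apply hstep hS, Measure.prod_apply (hstep hS)]
  have h1 : ∀ b, Prod.mk b ⁻¹' ((fun p : ℝ × ℝ => bestEffortStep M K p.1 p.2) ⁻¹' S)
      = bestEffortStep M K b ⁻¹' S := fun b => rfl
  simp_rw [h1, gammaMeasure_bestEffortStep_preimage hS]
  rw [lintegral_add_left, lintegral_lintegral_swap]
  · congr 1
    by_cases hK : K ∈ S <;> simp [hK]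
  · exact hj.aemeasurable
  · exact hj.lintegral_prod_right'

theorem stationary_singleton [SFinite ν] [SFinite (gammaMeasure a r)]
    (hν : (ν.prod (gammaMeasure a r)).map (fun p : ℝ × ℝ => bestEffortStep M K p.1 p.2) = ν) :
    ν {K} = ∫⁻ b, gammaMeasure a r (Ici (K - max (b - M) 0)) ∂ν := by
  rw [stationary_apply hν (measurableSet_singleton K)]
  simp

theorem stationary_eq_withDensity_add [SFinite ν] [SFinite (gammaMeasure a r)]
    (hν : (ν.prod (gammaMeasure a r)).map (fun p : ℝ × ℝ => bestEffortStep M K p.1 p.2) = ν) :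
    ν = (volume.restrict (Ioo 0 K)).withDensity
          (fun u => ∫⁻ b, gammaPDF a r (u - max (b - M) 0) ∂ν) + ν {K} • Measure.dirac K := by
  ext S hS
  rw [Measure.add_apply, withDensity_apply _ hS, Measure.restrict_restrict hS,
    Measure.smul_apply, Measure.dirac_apply' _ hS, smul_eq_mul, mul_comm (ν {K}),
    stationary_singleton hν]
  exact stationary_apply hν hS

end Stationary

/-- The integral at `x` sees only `b > x + M`, so `d` vanishes on `[K - j M, K)` by induction on
`j`, and finitely many stripes reach 0. -/
theorem eq_zero_of_eq_mul_integral_truncPow {M K lam : ℝ} (hM : 0 < M) (n : ℕ) {c d : ℝ → ℝ}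
    (h : ∀ x ∈ Ico 0 K, d x = c x *
      ∫ b in Ioo 0 K, truncPow n (x + M - b) * Real.exp (lam * b) * d b) :
    ∀ x ∈ Ico 0 K, d x = 0 := by
  have key : ∀ j : ℕ, ∀ x ∈ Ico 0 K, K - j * M ≤ x → d x = 0 := by
    intro j
    induction j with
    | zero =>
      intro x hx hj
      simp only [Nat.cast_zero, zero_mul, sub_zero] at hj
      exact absurd hx.2 (not_lt.2 hj)
    | succ j ih =>
      intro x hx hj
      rw [h x hx]
      have h0 : ∫ b in Ioo 0 K, truncPow n (x + M - b) * Real.exp (lam * b) * d b = 0 := by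
        refine integral_eq_zero_of_ae ((ae_restrict_mem measurableSet_Ioo).mono fun b hb => ?_)
        rcases lt_or_ge (x + M) b with hxb | hxb
        · have : d b = 0 := ih b ⟨hb.1.le, hb.2⟩ (by push_cast at hj; linarith)
          simp [this]
        · simp [truncPow_of_nonneg n (sub_nonneg.2 hxb)]
      rw [h0, mul_zero]
  intro x hx
  obtain ⟨j, hj⟩ := exists_nat_ge (K / M)
  refine key j x hx ?_
  have : K ≤ j * M := (div_le_iff₀ hM).1 hj
  linarith [hx.1]

section Stationary

variable {m l : ℕ} {M K lam : ℝ} {ν : Measure ℝ}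

/-- The pdf on `(0, K)` of the stored energy after one slot, started from `ν`. -/
noncomputable def nextPdf (m : ℕ) (M lam : ℝ) (ν : Measure ℝ) (x : ℝ) : ℝ :=
  ∫ b, gammaPDFReal m lam (x - max (b - M) 0) * 1 ∂ν

theorem integrable_gammaPDFReal_sub [IsFiniteMeasure ν] (hm : 1 ≤ m) (x : ℝ) :
    Integrable (fun b => gammaPDFReal m lam (x - max (b - M) 0) * 1) ν := by
  obtain ⟨C, hC⟩ := exists_bound_gammaPDFReal hm lam x
  refine Integrable.of_bound (Measurable.aestronglyMeasurable (by fun_prop)) C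
    (ae_of_all _ fun b => ?_)
  rw [mul_one]
  exact hC _ (by linarith [le_max_right (b - M) 0])

theorem measurable_nextPdf [SFinite ν] : Measurable (nextPdf m M lam ν) := by
  have : Measurable fun p : ℝ × ℝ => gammaPDFReal m lam (p.1 - max (p.2 - M) 0) * 1 := by fun_prop
  exact this.stronglyMeasurable.integral_prod_right'.measurable

theorem nextPdf_nonneg (hm : 1 ≤ m) (hlam : 0 < lam) (x : ℝ) : 0 ≤ nextPdf m M lam ν x :=
  integral_nonneg fun b => by
    have := gammaPDFReal_nonneg (a := m) (by exact_mod_cast hm) hlam (x - max (b - M) 0)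
    simpa using this

theorem ofReal_nextPdf [IsFiniteMeasure ν] (hm : 1 ≤ m) (hlam : 0 < lam) (x : ℝ) :
    ENNReal.ofReal (nextPdf m M lam ν x) = ∫⁻ b, gammaPDF m lam (x - max (b - M) 0) ∂ν := by
  rw [nextPdf, ofReal_integral_eq_lintegral_ofReal (integrable_gammaPDFReal_sub hm x)]
  · simp_rw [mul_one]
    rfl
  · refine ae_of_all _ fun b => ?_
    have := gammaPDFReal_nonneg (a := m) (by exact_mod_cast hm) hlam (x - max (b - M) 0)
    simpa using this

theorem stationary_eq_nextPdf [IsProbabilityMeasure ν] (hm : 1 ≤ m) (hlam : 0 < lam)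
    (hν : (ν.prod (gammaMeasure m lam)).map
      (fun p : ℝ × ℝ => bestEffortStep M K p.1 p.2) = ν) :
    ν = (volume.restrict (Ioo 0 K)).withDensity (fun x => ENNReal.ofReal (nextPdf m M lam ν x))
      + ν {K} • Measure.dirac K := by
  have := isProbabilityMeasure_gammaMeasure (a := m) (by exact_mod_cast hm) hlam
  simp_rw [ofReal_nextPdf hm hlam]
  exact stationary_eq_withDensity_add hν

theorem integrableOn_nextPdf [IsProbabilityMeasure ν] (hm : 1 ≤ m) (hlam : 0 < lam)
    (hν : (ν.prod (gammaMeasure m lam)).map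
      (fun p : ℝ × ℝ => bestEffortStep M K p.1 p.2) = ν) :
    IntegrableOn (nextPdf m M lam ν) (Ioo 0 K) := by
  refine ⟨measurable_nextPdf.aestronglyMeasurable, ?_⟩
  rw [hasFiniteIntegral_iff_ofReal (ae_of_all _ fun x => nextPdf_nonneg hm hlam x)]
  have h := congrArg (fun μ : Measure ℝ => μ univ) (stationary_eq_nextPdf hm hlam hν)
  simp only [Measure.add_apply, withDensity_apply _ MeasurableSet.univ, Measure.restrict_univ] at h
  refine lt_of_le_of_lt (le_trans le_self_add h.ge) (measure_lt_top ν univ)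

theorem integral_stationary [IsProbabilityMeasure ν] (hm : 1 ≤ m) (hlam : 0 < lam)
    (hν : (ν.prod (gammaMeasure m lam)).map
      (fun p : ℝ × ℝ => bestEffortStep M K p.1 p.2) = ν) {f : ℝ → ℝ} (hf : Measurable f)
    (hb : ∃ C, ∀ b ∈ Icc 0 K, |f b| ≤ C) :
    ∫ b, f b ∂ν = (∫ b in Ioo 0 K, f b * nextPdf m M lam ν b) + f K * ν.real {K} := by
  have hd : Measurable fun x => ENNReal.ofReal (nextPdf m M lam ν x) :=
    measurable_nextPdf.ennreal_ofReal
  have hfin : ∀ᵐ x ∂(volume.restrict (Ioo 0 K)), ENNReal.ofReal (nextPdf m M lam ν x) < ⊤ :=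
    ae_of_all _ fun x => ENNReal.ofReal_lt_top
  have hto : ∀ x, (ENNReal.ofReal (nextPdf m M lam ν x)).toReal = nextPdf m M lam ν x := fun x =>
    ENNReal.toReal_ofReal (nextPdf_nonneg hm hlam x)
  have hI : Integrable (fun b => f b * nextPdf m M lam ν b) (volume.restrict (Ioo 0 K)) :=
    integrable_mul_of_bound_Icc ((ae_restrict_mem measurableSet_Ioo).mono fun b h =>
      Ioo_subset_Icc_self h) (integrableOn_nextPdf hm hlam hν) hf hb
  conv_lhs => rw [stationary_eq_nextPdf hm hlam hν]
  rw [integral_add_measure, integral_withDensity_eq_integral_toReal_smul hd hfin,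
    integral_smul_measure, integral_dirac]
  · simp only [hto, smul_eq_mul, mul_comm (f _), measureReal_def]
  · rw [integrable_withDensity_iff_integrable_smul' hd hfin]
    simp only [hto, smul_eq_mul]
    exact hI.congr (ae_of_all _ fun b => mul_comm _ _)
  · exact (integrable_dirac enorm_lt_top).smul_measure (measure_ne_top _ _)

theorem stationary_fullMass [IsProbabilityMeasure ν] (hm : 1 ≤ m) (hlam : 0 < lam) (hM : 0 ≤ M)
    (hs : ∀ᵐ b ∂ν, b ∈ Icc 0 K)
    (hν : (ν.prod (gammaMeasure m lam)).map
      (fun p : ℝ × ℝ => bestEffortStep M K p.1 p.2) = ν) :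
    ν.real {K} = fullMass m K lam (storageMoment m M K lam ν fun _ => 1) := by
  have := isProbabilityMeasure_gammaMeasure (a := m) (by exact_mod_cast hm) hlam
  rw [← integral_erlangTail_mul hs (integrable_const _), measureReal_def, stationary_singleton hν,
    ← integral_toReal]
  · refine integral_congr_ae (hs.mono fun b hb => ?_)
    have : max (b - M) 0 ≤ K := max_le (by linarith [hb.2]) (hb.1.trans hb.2)
    simp only [mul_one]
    exact gammaMeasure_real_Ici hm hlam (by linarith)
  · have hmono : Antitone fun c => gammaMeasure m lam (Ici c) := fun c d h =>
      measure_mono (Ici_subset_Ici.2 h)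
    have hme : Measurable fun b : ℝ => K - max (b - M) 0 := by fun_prop
    exact (hmono.measurable.comp hme).aemeasurable
  · exact ae_of_all _ fun b => measure_lt_top _ _

/-- Stationarity makes `nextPdf` the pdf of `ν` itself. It solves the one-slot equation of
`storagePdf` with the same top part and the same atom, so the difference solves the homogeneous
equation. -/
theorem nextPdf_eq_storagePdf [IsProbabilityMeasure ν] (hm : 1 ≤ m) (hlam : 0 < lam) (hM : 0 < M)
    (hK : K < ((l : ℝ) + 1) * M) (hs : ∀ᵐ b ∂ν, b ∈ Icc 0 K)
    (hν : (ν.prod (gammaMeasure m lam)).map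
      (fun p : ℝ × ℝ => bestEffortStep M K p.1 p.2) = ν) :
    ∀ x ∈ Ico 0 K, nextPdf m M lam ν x
      = storagePdf m l M K lam (storageMoment m M K lam ν fun _ => 1) x := by
  set α := storageMoment m M K lam ν fun _ => 1 with hα
  have h := eq_zero_of_eq_mul_integral_truncPow (K := K) (lam := lam) hM (m - 1)
    (c := fun x => -(lam ^ m * Real.exp (-lam * (x + M))))
    (d := fun x => nextPdf m M lam ν x - storagePdf m l M K lam α x) (fun x hx => ?_)
  · exact fun x hx => sub_eq_zero.1 (h x hx)
  · have hbd := exists_bound_truncPow_mul_exp (m - 1) (x + M) lam K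
    have hmeas : Measurable fun b => truncPow (m - 1) (x + M - b) * Real.exp (lam * b) := by
      fun_prop
    have h1 : nextPdf m M lam ν x = _ :=
      integral_gammaPDFReal_sub_mul hm hs (integrable_const (1 : ℝ)) hx.1
    have h2 := storagePdf_eq_topPdf_sub (lam := lam) hm hM hK α hx.1 hx.2
    have hI : Integrable (fun b => truncPow (m - 1) (x + M - b) * Real.exp (lam * b) *
        nextPdf m M lam ν b) (volume.restrict (Ioo 0 K)) :=
      integrable_mul_of_bound_Icc ((ae_restrict_mem measurableSet_Ioo).mono fun b h =>
        Ioo_subset_Icc_self h) (integrableOn_nextPdf hm hlam hν) hmeas hbd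
    have h3 := integral_stationary hm hlam hν hmeas hbd
    simp only [mul_one] at h1
    rw [h3, stationary_fullMass hm hlam hM.le hs hν, ← hα] at h1
    rw [h1, h2]
    simp_rw [mul_sub]
    rw [integral_sub hI (integrableOn_mul_storagePdf hmeas hbd α)]
    ring

theorem integral_stationary_eq [IsProbabilityMeasure ν] (hm : 1 ≤ m) (hlam : 0 < lam) (hM : 0 < M)
    (hK : K < ((l : ℝ) + 1) * M) (hs : ∀ᵐ b ∂ν, b ∈ Icc 0 K)
    (hν : (ν.prod (gammaMeasure m lam)).map
      (fun p : ℝ × ℝ => bestEffortStep M K p.1 p.2) = ν) {f : ℝ → ℝ} (hf : Measurable f)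
    (hb : ∃ C, ∀ b ∈ Icc 0 K, |f b| ≤ C) :
    ∫ b, f b ∂ν = ∫ b, f b * storageWeight m l M K lam
      (storageMoment m M K lam ν fun _ => 1) b ∂(storageBase K) := by
  rw [integral_stationary hm hlam hν hf hb, integral_mul_storageWeight hf hb,
    stationary_fullMass hm hlam hM.le hs hν]
  congr 1
  refine setIntegral_congr_fun measurableSet_Ioo fun b hb => ?_
  rw [nextPdf_eq_storagePdf hm hlam hM hK hs hν b ⟨hb.1.le, hb.2⟩]

/-- `ν` is the distribution whose coefficients are its own moments `α`, and its mass is 1, so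
`coeffMatrix_mulVec` reads `A α = 1 - α`. -/
theorem stationary_linear_system [IsProbabilityMeasure ν] (hm : 1 ≤ m) (hlam : 0 < lam)
    (hM : 0 < M) (hK0 : 0 < K) (hl : 1 ≤ l) (hlo : (l : ℝ) * M ≤ K) (hK : K < ((l : ℝ) + 1) * M)
    (hs : ∀ᵐ b ∂ν, b ∈ Icc 0 K)
    (hν : (ν.prod (gammaMeasure m lam)).map
      (fun p : ℝ × ℝ => bestEffortStep M K p.1 p.2) = ν) :
    (1 + coeffMatrix m l M K lam) *ᵥ (storageMoment m M K lam ν fun _ => 1) = fun _ => 1 := by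
  have hE := fun {f : ℝ → ℝ} => integral_stationary_eq (f := f) hm hlam hM hK hs hν
  set α := storageMoment m M K lam ν fun _ => 1 with hα
  have h1 : ∫ b, storageWeight m l M K lam α b ∂(storageBase K) = 1 := by
    have := hE (f := fun _ => 1) measurable_const ⟨1, by simp⟩
    simpa using this.symm
  have h2 : ∀ s, storageMoment m M K lam (storageBase K) (storageWeight m l M K lam α) s = α s := by
    intro s
    have hc := continuous_moment_kernel M K lam s
    have := hE hc.measurable (exists_bound_Icc hc K)
    have hαs : α s = ∫ b, lam ^ (s : ℕ) * (K - max (b - M) 0) ^ (s : ℕ) *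
        Real.exp (lam * max (b - M) 0) ∂ν := by simp only [hα, storageMoment, mul_one]
    rw [hαs, storageMoment]
    exact this.symm
  funext s
  rw [Matrix.add_mulVec, Matrix.one_mulVec, Pi.add_apply,
    coeffMatrix_mulVec hm hM.le hK0 hlo hK.le hl, h1, h2]
  ring

end Stationary

/-! ### Uniqueness of the coefficients -/

section Uniqueness

variable {m l : ℕ} {M K lam : ℝ}

theorem topPdf_sub_const (γ : Fin m → ℝ) (T x : ℝ) :
    topPdf m K lam (fun r => γ r - T) x
      = topPdf m K lam γ x - T * topPdf m K lam (fun _ => 1) x := by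
  unfold topPdf
  rw [mul_left_comm T, ← mul_sub, Finset.mul_sum _ _ T, ← Finset.sum_sub_distrib]
  congr 1
  exact Finset.sum_congr rfl fun r _ => by ring

theorem fullMass_sub_const (γ : Fin m → ℝ) (T : ℝ) :
    fullMass m K lam (fun r => γ r - T)
      = fullMass m K lam γ - T * fullMass m K lam (fun _ => 1) := by
  unfold fullMass
  rw [mul_left_comm T, ← mul_sub, Finset.mul_sum _ _ T, ← Finset.sum_sub_distrib]
  congr 1
  exact Finset.sum_congr rfl fun r _ => by ring

theorem continuous_topPdf (γ : Fin m → ℝ) : Continuous (topPdf m K lam γ) := by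
  unfold topPdf
  fun_prop

/-- This is the total mass in the degenerate case `l = 0`, `M = 0`, where `storagePdf` is the top
stripe alone. Regrouping the double sum by total degree `k` produces the binomial `(1 - λ K) ^ k /
k!`. -/
theorem integral_topPdf_add_fullMass (hm : 1 ≤ m) (hK : 0 ≤ K) :
    (∫ x in Ioo 0 K, topPdf m K lam (fun _ => 1) x) + fullMass m K lam (fun _ => 1)
      = ∑ k ∈ Finset.range m, (1 - lam * K) ^ k / (k ! : ℝ) := by
  have h := integral_tail_storageWeight (m := m) (l := 0) (L := 0) (M := 0) (K := K) (lam := lam)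
    hm (fun _ => 1) (c := 0) le_rfl le_rfl le_rfl (fun q hq => by simpa using hK)
    (fun q h1 h2 => by omega)
  have h0 : ∀ᵐ b ∂(storageBase K), (Ici 0).indicator 1 b *
      storageWeight m 0 0 K lam (fun _ => 1) b = storageWeight m 0 0 K lam (fun _ => 1) b :=
    (ae_storageBase_mem_Icc hK).mono fun b hb => by
      rw [indicator_of_mem (show b ∈ Ici (0 : ℝ) from hb.1)]; simp
  rw [integral_congr_ae h0, integral_storageWeight] at h
  have h1 : ∫ x in Ioo 0 K, topPdf m K lam (fun _ => 1) x
      = ∫ x in Ioo 0 K, storagePdf m 0 0 K lam (fun _ => 1) x := by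
    refine setIntegral_congr_fun measurableSet_Ioo fun x hx => ?_
    have hxK : x - K < 0 := sub_neg.2 hx.2
    simp [topPdf, storagePdf, truncPow_of_neg _ hxK]
  rw [h1, h]
  have h2 : ∀ k ∈ Finset.range m, (1 - lam * K) ^ k / (k ! : ℝ)
      = ∑ r ∈ Finset.range (k + 1), 1 / (r ! : ℝ) * ((-(lam * K)) ^ (k - r) / ((k - r)! : ℝ)) := by
    intro k _
    rw [sub_eq_add_neg, add_pow, Finset.sum_div]
    refine Finset.sum_congr rfl fun r hr => ?_
    have hrk : r ≤ k := Nat.lt_succ_iff.1 (Finset.mem_range.1 hr)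
    have hch : ((k.choose r : ℕ) : ℝ) * (r ! : ℝ) * ((k - r)! : ℝ) = (k ! : ℝ) := by
      exact_mod_cast Nat.choose_mul_factorial_mul_factorial hrk
    have h1 : (r ! : ℝ) ≠ 0 := by positivity
    have h2 : ((k - r)! : ℝ) ≠ 0 := by positivity
    have h3 : ((k.choose r : ℕ) : ℝ) ≠ 0 := by exact_mod_cast (Nat.choose_pos hrk).ne'
    rw [one_pow, ← hch]
    field_simp
  rw [Finset.sum_congr rfl h2, Finset.sum_range_diag_flip m
    (fun r t => 1 / (r ! : ℝ) * ((-(lam * K)) ^ t / (t ! : ℝ))),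
    ← Fin.sum_univ_eq_sum_range (fun r => ∑ t ∈ Finset.range (m - r),
      1 / (r ! : ℝ) * ((-(lam * K)) ^ t / (t ! : ℝ)))]
  refine Finset.sum_congr rfl fun r _ => ?_
  rw [← Finset.mul_sum]
  simp

variable {ρ : Measure ℝ} {w : ℝ → ℝ}

theorem integrable_prod_gammaPDFReal [SFinite ρ] (hm : 1 ≤ m) (hw : Integrable w ρ) :
    Integrable (fun p : ℝ × ℝ => gammaPDFReal m lam (p.1 - max (p.2 - M) 0) * w p.2)
      ((volume.restrict (Ioo 0 K)).prod ρ) := by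
  obtain ⟨C, hC⟩ := exists_bound_gammaPDFReal hm lam K
  refine (hw.comp_snd (volume.restrict (Ioo 0 K))).bdd_mul (c := C)
    (Measurable.aestronglyMeasurable (by fun_prop)) ?_
  have : ∀ᵐ p ∂((volume.restrict (Ioo 0 K)).prod ρ), p.1 ∈ Ioo 0 K :=
    Measure.quasiMeasurePreserving_fst.ae (ae_restrict_mem measurableSet_Ioo)
  exact this.mono fun p hp => hC _ (by linarith [hp.2, le_max_right (p.2 - M) 0])

/-- Mass balance of one slot: what does not land in `(0, K)` fills the buffer. -/
theorem integral_integral_gammaPDFReal [SFinite ρ] (hm : 1 ≤ m) (hM : 0 ≤ M)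
    (hρ : ∀ᵐ b ∂ρ, b ∈ Icc 0 K) (hw : Integrable w ρ) :
    ∫ x in Ioo 0 K, ∫ b, gammaPDFReal m lam (x - max (b - M) 0) * w b ∂ρ
      = (∫ b, w b ∂ρ) - ∫ b, erlangTail m lam (K - max (b - M) 0) * w b ∂ρ := by
  rw [integral_integral_swap (integrable_prod_gammaPDFReal hm hw), ← integral_sub hw]
  · refine integral_congr_ae (hρ.mono fun b hb => ?_)
    have hY : max (b - M) 0 ≤ K := max_le (by linarith [hb.2]) (hb.1.trans hb.2)
    simp only
    rw [integral_mul_const, integral_gammaPDFReal hm lam (le_max_right _ _) hY]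
    ring
  · exact integrable_continuous_mul hρ hw (by unfold erlangTail; fun_prop)

/-- The filling probability is at least `erlangTail m lam K` from every level. As the mass is zero,
this constant can be subtracted inside the integral for the atom before absolute values are taken;
the L¹ norm is then at most `1 - erlangTail m lam K` times itself. -/
theorem eq_zero_of_storageWeight_stationary (hm : 1 ≤ m) (hlam : 0 < lam) (hM : 0 ≤ M) (hK : 0 < K)
    (γ : Fin m → ℝ)
    (hpdf : ∀ x ∈ Ioo 0 K, storagePdf m l M K lam γ x = ∫ b, gammaPDFReal m lam (x - max (b - M) 0) *
      storageWeight m l M K lam γ b ∂(storageBase K))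
    (hfull : fullMass m K lam γ = ∫ b, erlangTail m lam (K - max (b - M) 0) *
      storageWeight m l M K lam γ b ∂(storageBase K))
    (hT : ∫ b, storageWeight m l M K lam γ b ∂(storageBase K) = 0) :
    storageWeight m l M K lam γ =ᵐ[storageBase K] 0 := by
  have hρ := ae_storageBase_mem_Icc hK.le
  have hw := integrable_storageWeight (l := l) (M := M) (K := K) (lam := lam) γ
  have hpdfI : IntegrableOn (storagePdf m l M K lam γ) (Ioo 0 K) := by
    simpa using integrableOn_mul_storagePdf (l := l) (M := M) (K := K) (lam := lam)
      (f := fun _ => 1) measurable_const ⟨1, by simp⟩ γ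
  have hN : ∫ b, |storageWeight m l M K lam γ b| ∂(storageBase K)
      = (∫ b in Ioo 0 K, |storagePdf m l M K lam γ b|) + |fullMass m K lam γ| := by
    have hae : (fun b => |storageWeight m l M K lam γ b|)
        =ᵐ[volume.restrict (Ioo 0 K)] fun b => |storagePdf m l M K lam γ b| :=
      (storageWeight_ae_eq (l := l) (M := M) (lam := lam) γ).mono fun b h => by simp only [h]
    rw [storageBase, integral_add_measure (hpdfI.abs.congr hae.symm)
      (integrable_dirac enorm_lt_top), integral_congr_ae hae, integral_dirac]
    simp [storageWeight]
  set w := storageWeight m l M K lam γ with hwdef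
  have hcont : Continuous fun b => erlangTail m lam (K - max (b - M) 0) := by
    unfold erlangTail; fun_prop
  have hEw := integrable_continuous_mul hρ hw hcont
  have hEa := integrable_continuous_mul hρ hw.abs hcont
  have h1 : ∫ b in Ioo 0 K, |storagePdf m l M K lam γ b|
      ≤ (∫ b, |w b| ∂(storageBase K))
        - ∫ b, erlangTail m lam (K - max (b - M) 0) * |w b| ∂(storageBase K) := by
    rw [← integral_integral_gammaPDFReal hm hM hρ hw.abs]
    refine setIntegral_mono_on hpdfI.abs
      (integrable_prod_gammaPDFReal hm hw.abs).integral_prod_left measurableSet_Ioo fun x hx => ?_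
    rw [hpdf x hx]
    refine abs_integral_le_integral_abs.trans (le_of_eq (integral_congr_ae (ae_of_all _ fun b => ?_)))
    simp only [abs_mul]
    rw [abs_of_nonneg (gammaPDFReal_nonneg (by exact_mod_cast hm) hlam _)]
  have h2 : |fullMass m K lam γ|
      ≤ (∫ b, erlangTail m lam (K - max (b - M) 0) * |w b| ∂(storageBase K))
        - erlangTail m lam K * ∫ b, |w b| ∂(storageBase K) := by
    have e : fullMass m K lam γ = ∫ b, (erlangTail m lam (K - max (b - M) 0) * w b
        - erlangTail m lam K * w b) ∂(storageBase K) := by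
      rw [integral_sub hEw (hw.const_mul _), integral_const_mul, hT, hfull]
      ring
    rw [e, ← integral_const_mul, ← integral_sub hEa (hw.abs.const_mul _)]
    refine abs_integral_le_integral_abs.trans (le_of_eq (integral_congr_ae (hρ.mono fun b hb => ?_)))
    have hY : max (b - M) 0 ≤ K := max_le (by linarith [hb.2]) (hb.1.trans hb.2)
    have := erlangTail_antitone hm hlam (c := K - max (b - M) 0) (d := K) (by linarith)
      (by linarith [le_max_right (b - M) 0])
    simp only
    rw [← sub_mul, ← sub_mul, abs_mul, abs_of_nonneg (sub_nonneg.2 this)]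
  have h3 : erlangTail m lam K * ∫ b, |w b| ∂(storageBase K) ≤ 0 := by linarith
  have h4 : ∫ b, |w b| ∂(storageBase K) = 0 :=
    le_antisymm (nonpos_of_mul_nonpos_right h3 (erlangTail_pos hm hlam hK.le))
      (integral_nonneg fun b => abs_nonneg _)
  have h5 := (integral_eq_zero_iff_of_nonneg (fun b => abs_nonneg (w b)) hw.abs).1 h4
  exact h5.mono fun b hb => abs_eq_zero.1 hb

theorem eq_zero_of_coeffMatrix_mulVec_eq_neg (hm : 1 ≤ m) (hlam : 0 < lam) (hM : 0 < M)
    (hK0 : 0 < K) (hl : 1 ≤ l) (hlo : (l : ℝ) * M ≤ K) (hK : K < ((l : ℝ) + 1) * M)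
    (hne : ∑ k ∈ Finset.range m, (1 - lam * K) ^ k / (k ! : ℝ) ≠ 0) {γ : Fin m → ℝ}
    (hγ : (1 + coeffMatrix m l M K lam) *ᵥ γ = 0) : γ = 0 := by
  have hρ := ae_storageBase_mem_Icc hK0.le
  have hw := integrable_storageWeight (l := l) (M := M) (K := K) (lam := lam) γ
  have hI := integral_storageWeight (l := l) (M := M) (K := K) (lam := lam) γ
  have hrow : ∀ s, γ s = storageMoment m M K lam (storageBase K) (storageWeight m l M K lam γ) s
      - ∫ b, storageWeight m l M K lam γ b ∂(storageBase K) := by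
    intro s
    have h := congrFun hγ s
    rw [Matrix.add_mulVec, Matrix.one_mulVec, Pi.add_apply,
      coeffMatrix_mulVec hm hM.le hK0 hlo hK.le hl, Pi.zero_apply] at h
    linarith
  set T := ∫ b, storageWeight m l M K lam γ b ∂(storageBase K) with hTdef
  have hγeq : γ = fun s => storageMoment m M K lam (storageBase K)
      (storageWeight m l M K lam γ) s - T := funext hrow
  have hpdf : ∀ x ∈ Ioo 0 K, storagePdf m l M K lam γ x
      = (∫ b, gammaPDFReal m lam (x - max (b - M) 0) * storageWeight m l M K lam γ b ∂(storageBase K))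
        - T * topPdf m K lam (fun _ => 1) x := by
    intro x hx
    rw [integral_gammaPDFReal_sub_mul hm hρ hw hx.1.le,
      integral_mul_storageWeight (by fun_prop) (exists_bound_truncPow_mul_exp _ _ _ _),
      storagePdf_eq_topPdf_sub hm hM hK γ hx.1.le hx.2]
    have := congrArg (fun β => topPdf m K lam β x) hγeq
    simp only [topPdf_sub_const] at this
    rw [this]
    ring
  have hfull : fullMass m K lam γ
      = (∫ b, erlangTail m lam (K - max (b - M) 0) * storageWeight m l M K lam γ b ∂(storageBase K))
        - T * fullMass m K lam (fun _ => 1) := by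
    rw [integral_erlangTail_mul hρ hw]
    have := congrArg (fun β => fullMass m K lam β) hγeq
    simpa only [fullMass_sub_const] using this
  -- Adding pdf and atom over one slot, all mass balances except `T` times the total mass belonging
  -- to unit coefficients, which is the exceptional sum.
  have hT0 : T = 0 := by
    have hbal := integral_integral_gammaPDFReal (lam := lam) hm hM.le hρ hw
    have h1 : ∫ x in Ioo 0 K, storagePdf m l M K lam γ x
        = (∫ x in Ioo 0 K, ∫ b, gammaPDFReal m lam (x - max (b - M) 0) *
            storageWeight m l M K lam γ b ∂(storageBase K))
          - T * ∫ x in Ioo 0 K, topPdf m K lam (fun _ => 1) x := by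
      rw [setIntegral_congr_fun measurableSet_Ioo hpdf, integral_sub, integral_const_mul]
      · exact (integrable_prod_gammaPDFReal hm hw).integral_prod_left
      · exact (((continuous_topPdf _).integrableOn_Icc (a := 0) (b := K)).mono_set
          Ioo_subset_Icc_self).const_mul _
    have h2 := integral_topPdf_add_fullMass (lam := lam) hm hK0.le
    have h3 : T * ∑ k ∈ Finset.range m, (1 - lam * K) ^ k / (k ! : ℝ) = 0 := by
      rw [← h2]
      rw [h1, hbal, hfull] at hI
      linarith
    exact (mul_eq_zero.1 h3).resolve_right hne
  have hzero := eq_zero_of_storageWeight_stationary hm hlam hM.le hK0 γ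
    (fun x hx => by rw [hpdf x hx, hT0]; ring) (by rw [hfull, hT0]; ring) hT0
  funext s
  rw [hrow s, hT0, sub_zero, storageMoment]
  refine integral_eq_zero_of_ae (hzero.mono fun b hb => ?_)
  simp [hb]

end Uniqueness

theorem mainTheorem5 (m l : ℕ) (hm : 1 ≤ m) (hl : 1 ≤ l)
    (M Δ K Xbar lam : ℝ) (hM : 0 < M) (hΔ : 0 ≤ Δ) (hΔM : Δ < M)
    (hK : K = (l : ℝ) * M + Δ) (hXbar : 0 < Xbar) (hlam : lam = (m : ℝ) / Xbar) :
    ∃ (ν : Measure ℝ) (g : ℝ → ℝ) (α : Fin m → ℝ),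
      -- `ν` is the limiting distribution under Gamma harvesting with shape `m` and rate `lam`
      IsBestEffortLimit.{u} M K (gammaMeasure (m : ℝ) lam) ν ∧
      -- `ν` has the pdf `g` on `(0, K)` and an atom at `K`
      ν = (volume.restrict (Ioo 0 K)).withDensity (fun x => ENNReal.ofReal (g x))
            + ν {K} • Measure.dirac K ∧
      (∀ x ∈ Ico 0 K, 0 ≤ g x) ∧
      -- `g = g_n` on the stripes
      (∀ n : ℕ, n ≤ (if Δ = 0 then l - 1 else l) →
        ∀ x ∈ Ico (max 0 (K - ((n : ℝ) + 1) * M)) (K - (n : ℝ) * M),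
          g x = stripePdf m M K lam α n x) ∧
      -- probability of a full buffer
      ν.real {K} = Real.exp (-lam * K) * ∑ r : Fin m, α r / ((r : ℕ)! : ℝ) ∧
      -- the linear system for the coefficients
      (1 + coeffMatrix m l M K lam) *ᵥ α = (fun _ => 1) ∧
      -- it determines them, unless `lam * K` is the exceptional value
      (∑ k ∈ Finset.range m, (1 - lam * K) ^ k / (k ! : ℝ) ≠ 0 →
        ∀ β : Fin m → ℝ, (1 + coeffMatrix m l M K lam) *ᵥ β = (fun _ => 1) → β = α) := by
  have hm0 : (0 : ℝ) < m := by exact_mod_cast hm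
  have hlam0 : 0 < lam := hlam ▸ div_pos hm0 hXbar
  have hlo : (l : ℝ) * M ≤ K := by linarith
  have hhi : K < ((l : ℝ) + 1) * M := by linarith
  have hK0 : 0 < K := lt_of_lt_of_le (mul_pos (by exact_mod_cast hl) hM) hlo
  have := isProbabilityMeasure_gammaMeasure hm0 hlam0
  have hne := gammaMeasure_Ici_ne_zero hm hlam0 hK0.le
  obtain ⟨ν, hpr, hν⟩ := exists_stationary_bestEffort M K (gammaMeasure m lam) hne
  have hlim : IsBestEffortLimit.{u} M K (gammaMeasure (m : ℝ) lam) ν :=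
    IsBestEffortLimit.of_stationary hK0.le hν (ae_gammaMeasure_nonneg _ _) hne
  have hsys := stationary_linear_system hm hlam0 hM hK0 hl hlo hhi hlim.support hν
  have hpdf := nextPdf_eq_storagePdf hm hlam0 hM hhi hlim.support hν
  refine ⟨ν, nextPdf m M lam ν, storageMoment m M K lam ν fun _ => 1, hlim,
    stationary_eq_nextPdf hm hlam0 hν, fun x _ => nextPdf_nonneg hm hlam0 x, ?_,
    stationary_fullMass hm hlam0 hM.le hlim.support hν, hsys, ?_⟩
  · rintro n - x ⟨hx1, hx2⟩
    have hx0 : 0 ≤ x := (le_max_left _ _).trans hx1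
    have hnM : 0 ≤ (n : ℝ) * M := by positivity
    rw [hpdf x ⟨hx0, by linarith⟩]
    exact storagePdf_eq_stripePdf hM hhi _ hx0 ((le_max_right _ _).trans hx1) hx2
  · intro hsum β hβ
    refine sub_eq_zero.1 (eq_zero_of_coeffMatrix_mulVec_eq_neg hm hlam0 hM hK0 hl hlo hhi hsum ?_)
    rw [Matrix.mulVec_sub, hβ, hsys, sub_self]
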